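/- **Setting.** Let $\mathbb T$ be $\mathbb R$ or $\mathbb Z$ (more generally, any linearly ordered abelian group) and $\mathbb T_+=\{t\in\mathbb T: t\ge 0\}$. Let $\mathcal B_0$ be a $C^*$-algebra, $(\lambda_t)_{t\in\mathbb T_+}$ a semigroup of injective $*$-endomorphisms of $\mathcal B_0$ (with $\lambda_0=\mathrm{id}$), and $\psi$ a state on $\mathcal B_0$ with $\psi\circ\lambda_t=\psi$ for all $t\ge 0$. Let $\mathcal B_{[-\infty}$ be the inductive limit $C^*$-algebra: it comes with injective $*$-homomorphisms $i_t:\mathcal B_0\to\mathcal B_{[-\infty}$ ($t\in\mathbb T$) such that $i_{s+t}=i_s\circ\lambda_t$ for $s\in\mathbb T$, $t\ge 0$, and such that the union of the subalgebras $\mathcal B_{[t}=i_t(\mathcal B_0)$ is dense. Let $\psi_{[-\infty}$ be the state on $\mathcal B_{[-\infty}$ with $\psi_{[-\infty}\circ i_t=\psi$ for all $t\in\mathbb T$, and let $(\mathcal H,\pi,\Omega)$ be its GNS triple. For $t\in\mathbb T$ let $F_{t]}$ be the support projection of the vector state of $\Omega$ in the von Neumann algebra $\pi(\mathcal B_{[t})''$,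 i.e. the smallest projection of this algebra that fixes $\Omega$, which is the projection onto $\overline{\pi(\mathcal B_{[t})'\Omega}$. The projections $F_{t]}$ decrease as $t\to-\infty$; let $Q$ be their strong limit. The system $(\mathcal B_{[-\infty},\psi_{[-\infty})$ is called *Kolmogorov* if $Q=|\Omega\rangle\langle\Omega|$. Let $(\mathcal H_0,\pi_0,\Omega_0)$ be the GNS triple of $(\mathcal B_0,\psi)$, let $P$ be the support projection of the vector state of $\Omega_0$ in $\pi_0(\mathcal B_0)''$, and put $\mathcal A_0=P\pi_0(\mathcal B_0)''P$ and $\phi_0(x)=\langle\Omega_0,x\Omega_0\rangle$ for $x\in\mathcal A_0$. For $t\ge 0$ let $\tau_t:\mathcal A_0\to\mathcal A_0$ be given by $\tau_t(x)=P\lambda_t(PxP)P$. Here, for $X\in\pi_0(\mathcal B_0)''$, the operator $\lambda_t(X)P$ is defined as follows: if $V_t$ is the isometry of $\mathcal H_0$ with $V_t\pi_0(b)\Omega_0=\pi_0(\lambda_t(b))\Omega_0$ for $b\in\mathcal B_0$, then $\lambda_t(X)P$ is the bounded operator that maps $m\Omega_0$ to $mV_tX\Omega_0$ for every $m\in\pi_0(\mathcal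 B_0)'$ and vanishes on the range of $1-P$. (If $\lambda_t$ extends to a normal endomorphism of $\pi_0(\mathcal B_0)''$, also denoted $\lambda_t$, this is the product of $\lambda_t(X)$ and $P$. In every case $\tau_t(P\pi_0(b)P)=P\pi_0(\lambda_t(b))P$ for $b\in\mathcal B_0$.) **Theorem 3.3.** The system $(\mathcal B_{[-\infty},\psi_{[-\infty})$ is Kolmogorov, i.e. $Q=|\Omega\rangle\langle\Omega|$, if and only if $$\phi_0(\tau_t(x)\tau_t(y))\longrightarrow\phi_0(x)\,\phi_0(y)\qquad\text{as } t\to\infty,\ \text{for all } x,y\in\mathcal A_0 .$$ -/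

import Mathlib

open Filter Topology
open scoped InnerProductSpace ComplexOrder

namespace InductiveLimitState

/-! ### States, semigroups of endomorphisms, inductive limits, GNS triples -/

section Basic

/-- A state of a (not necessarily unital) C⋆-algebra: a positive linear functional of norm one. -/
structure IsState {B : Type*} [NonUnitalCStarAlgebra B] (ψ : B →L[ℂ] ℂ) : Prop where
  nonneg : ∀ b, 0 ≤ ψ (star b * b)
  norm_eq_one : ‖ψ‖ = 1

/-- A one-parameter semigroup, with parameters in the positive cone `T₊` of `T`, of injective
endomorphisms of the C⋆-algebra `B`. -/
structure EndoSemigroup (T : Type*) [AddCommGroup T] [LinearOrder T] [IsOrderedAddMonoid T]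
    (B : Type*) [NonUnitalCStarAlgebra B] where
  endo : {t : T // 0 ≤ t} → (B →⋆ₙₐ[ℂ] B)
  endo_zero : ∀ b, endo 0 b = b
  endo_add : ∀ s t b, endo (s + t) b = endo s (endo t b)
  endo_injective : ∀ t, Function.Injective (endo t)

variable {T : Type*} [AddCommGroup T] [LinearOrder T] [IsOrderedAddMonoid T]
variable {B₀ B : Type*} [NonUnitalCStarAlgebra B₀] [NonUnitalCStarAlgebra B]

/-- `B`, with the embeddings `i t` of `B₀` onto the subalgebras `B_[t = i t (B₀)`, is the inductive
limit C⋆-algebra of the system of copies of `B₀`, indexed by `T`, in which the copy at `s + t` is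
mapped to the copy at `s` by the endomorphism with parameter `t ≥ 0`. -/
structure IsInductiveLimit (S : EndoSemigroup T B₀) (i : T → (B₀ →⋆ₙₐ[ℂ] B)) : Prop where
  injective : ∀ t, Function.Injective (i t)
  compat : ∀ (s : T) (t : {t : T // 0 ≤ t}) (b : B₀), i (s + t) b = i s (S.endo t b)
  dense : closure (⋃ t, Set.range (i t)) = Set.univ

variable {H : Type*} [NormedAddCommGroup H] [InnerProductSpace ℂ H] [CompleteSpace H]

/-- `(H, π, Ω)` is the GNS triple of the state `ψ` (unique up to unitary equivalence). -/
structure IsGNS (ψ : B →L[ℂ] ℂ) (π : B →⋆ₙₐ[ℂ] (H →L[ℂ] H)) (Ω : H) : Prop where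
  norm_eq_one : ‖Ω‖ = 1
  inner_eq : ∀ b, ⟪Ω, π b Ω⟫_ℂ = ψ b
  cyclic : DenseRange fun b => π b Ω

/-- The von Neumann algebra `ρ(B)''` generated by a representation `ρ`. -/
noncomputable def vonNeumann (ρ : B →⋆ₙₐ[ℂ] (H →L[ℂ] H)) : VonNeumannAlgebra H where
  toStarSubalgebra :=
    StarSubalgebra.centralizer ℂ (StarSubalgebra.centralizer ℂ (Set.range ρ) : Set (H →L[ℂ] H))
  centralizer_centralizer' := by
    change Set.centralizer (Set.centralizer (StarSubalgebra.centralizer ℂ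
      (StarSubalgebra.centralizer ℂ (Set.range ρ) : Set (H →L[ℂ] H)) : Set (H →L[ℂ] H))) =
      (StarSubalgebra.centralizer ℂ
      (StarSubalgebra.centralizer ℂ (Set.range ρ) : Set (H →L[ℂ] H)) : Set (H →L[ℂ] H))
    rw [StarSubalgebra.coe_centralizer_centralizer]
    simp

theorem star_range (ρ : B →⋆ₙₐ[ℂ] (H →L[ℂ] H)) : star (Set.range ρ) = Set.range ρ := by
  ext x
  simp only [Set.mem_star, Set.mem_range]
  constructor
  · rintro ⟨b, hb⟩
    exact ⟨star b, by rw [map_star, hb, star_star]⟩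
  · rintro ⟨b, hb⟩
    exact ⟨star b, by rw [map_star, hb]⟩

theorem coe_vonNeumann (ρ : B →⋆ₙₐ[ℂ] (H →L[ℂ] H)) :
    (vonNeumann ρ : Set (H →L[ℂ] H)) = Set.centralizer (Set.centralizer (Set.range ρ)) := by
  change (StarSubalgebra.centralizer ℂ
      (StarSubalgebra.centralizer ℂ (Set.range ρ) : Set (H →L[ℂ] H)) : Set (H →L[ℂ] H)) = _
  rw [StarSubalgebra.coe_centralizer_centralizer, star_range, Set.union_self]

theorem map_mem_vonNeumann (ρ : B →⋆ₙₐ[ℂ] (H →L[ℂ] H)) (b : B) : ρ b ∈ vonNeumann ρ := by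
  rw [← SetLike.mem_coe, coe_vonNeumann]
  exact Set.subset_centralizer_centralizer ⟨b, rfl⟩

theorem mem_commutant_vonNeumann (ρ : B →⋆ₙₐ[ℂ] (H →L[ℂ] H)) (m : H →L[ℂ] H) :
    m ∈ (vonNeumann ρ).commutant ↔ ∀ b, ρ b * m = m * ρ b := by
  rw [← SetLike.mem_coe, VonNeumannAlgebra.coe_commutant, coe_vonNeumann,
    Set.centralizer_centralizer_centralizer]
  simp [Set.mem_centralizer_iff]

theorem vonNeumann_mono {B' : Type*} [NonUnitalCStarAlgebra B'] {ρ : B →⋆ₙₐ[ℂ] (H →L[ℂ] H)}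
    {ρ' : B' →⋆ₙₐ[ℂ] (H →L[ℂ] H)} (h : Set.range ρ ⊆ Set.range ρ') :
    (vonNeumann ρ' ).commutant ≤ (vonNeumann ρ).commutant := by
  intro m hm
  rw [mem_commutant_vonNeumann] at hm ⊢
  intro b
  obtain ⟨b', hb'⟩ := h ⟨b, rfl⟩
  rw [← hb', hm]

end Basic

/-! ### Support projections -/

section Support

variable {H : Type*} [NormedAddCommGroup H] [InnerProductSpace ℂ H] [CompleteSpace H]

/-- The map `m ↦ m Ω` on the commutant of `M`. -/
noncomputable def commutantOrbit (M : VonNeumannAlgebra H) (Ω : H) :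
    M.commutant.toStarSubalgebra →ₗ[ℂ] H where
  toFun m := (m : H →L[ℂ] H) Ω
  map_add' _ _ := rfl
  map_smul' _ _ := rfl

/-- The closed subspace `[M'Ω]`. -/
noncomputable def supportSubspace (M : VonNeumannAlgebra H) (Ω : H) : Submodule ℂ H :=
  (LinearMap.range (commutantOrbit M Ω)).topologicalClosure

noncomputable instance (M : VonNeumannAlgebra H) (Ω : H) : CompleteSpace (supportSubspace M Ω) :=
  inferInstanceAs (CompleteSpace (LinearMap.range (commutantOrbit M Ω)).topologicalClosure)

/-- The support projection in `M` of the vector state given by `Ω`, i.e. the orthogonal projection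
onto `[M'Ω]`; by `supportProj_isLeast` it is the smallest projection in `M` that fixes `Ω`. -/
noncomputable def supportProj (M : VonNeumannAlgebra H) (Ω : H) : H →L[ℂ] H :=
  (supportSubspace M Ω).starProjection

theorem apply_mem_supportSubspace {M : VonNeumannAlgebra H} {Ω : H} {m : H →L[ℂ] H}
    (hm : m ∈ M.commutant) : m Ω ∈ supportSubspace M Ω :=
  Submodule.le_topologicalClosure _ ⟨⟨m, hm⟩, rfl⟩

theorem supportProj_apply_orbit {M : VonNeumannAlgebra H} {Ω : H} {m : H →L[ℂ] H}
    (hm : m ∈ M.commutant) : supportProj M Ω (m Ω) = m Ω :=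
  Submodule.starProjection_eq_self_iff.2 (apply_mem_supportSubspace hm)

theorem supportProj_apply_self (M : VonNeumannAlgebra H) (Ω : H) : supportProj M Ω Ω = Ω := by
  simpa using supportProj_apply_orbit (M := M) (Ω := Ω) (one_mem M.commutant)

theorem mapsTo_supportSubspace {M : VonNeumannAlgebra H} {Ω : H} {m : H →L[ℂ] H}
    (hm : m ∈ M.commutant) {ξ : H} (hξ : ξ ∈ supportSubspace M Ω) :
    m ξ ∈ supportSubspace M Ω := by
  refine map_mem_closure m.continuous hξ ?_
  rintro _ ⟨n, rfl⟩
  exact ⟨⟨m * n, mul_mem hm n.2⟩, rfl⟩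

theorem isStarProjection_supportProj (M : VonNeumannAlgebra H) (Ω : H) :
    IsStarProjection (supportProj M Ω) := isStarProjection_starProjection

theorem supportProj_mem (M : VonNeumannAlgebra H) (Ω : H) : supportProj M Ω ∈ M := by
  rw [VonNeumannAlgebra.IsStarProjection.mem_iff (isStarProjection_supportProj M Ω)]
  intro y hy
  rw [supportProj, Submodule.range_starProjection]
  intro ξ hξ
  exact mapsTo_supportSubspace hy hξ

theorem supportProj_isLeast (M : VonNeumannAlgebra H) (Ω : H) :
    IsLeast {E : H →L[ℂ] H | E ∈ M ∧ IsStarProjection E ∧ E Ω = Ω} (supportProj M Ω) := by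
  refine ⟨⟨supportProj_mem M Ω, isStarProjection_supportProj M Ω, supportProj_apply_self M Ω⟩, ?_⟩
  rintro E ⟨hE, hEp, hEΩ⟩
  refine (isStarProjection_supportProj M Ω).le_of_mul_eq_right hEp ?_
  ext ξ
  have h : supportSubspace M Ω ≤ LinearMap.eqLocus (E : H →ₗ[ℂ] H) LinearMap.id := by
    refine Submodule.topologicalClosure_minimal _ ?_ (isClosed_eq E.continuous continuous_id)
    rintro _ ⟨m, rfl⟩
    have := DFunLike.congr_fun (VonNeumannAlgebra.mem_commutant_iff.1 m.2 E hE) Ω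
    simpa [commutantOrbit, hEΩ] using this
  exact h (Submodule.starProjection_apply_mem _ ξ)

end Support

/-! ### The filtration of support projections and its limit -/

section Filtration

variable {T : Type*} [AddCommGroup T] [LinearOrder T] [IsOrderedAddMonoid T]
variable {B₀ B : Type*} [NonUnitalCStarAlgebra B₀] [NonUnitalCStarAlgebra B]
variable {H : Type*} [NormedAddCommGroup H] [InnerProductSpace ℂ H] [CompleteSpace H]

/-- The von Neumann algebra `π(B_[t)''`, where `B_[t = i t (B₀)`. -/
noncomputable def localAlgebra (i : T → (B₀ →⋆ₙₐ[ℂ] B)) (π : B →⋆ₙₐ[ℂ] (H →L[ℂ] H)) (t : T) :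
    VonNeumannAlgebra H :=
  vonNeumann (π.comp (i t))

/-- `F_t]`: the support projection in `π(B_[t)''` of the vector state given by `Ω`. -/
noncomputable def filtration (i : T → (B₀ →⋆ₙₐ[ℂ] B)) (π : B →⋆ₙₐ[ℂ] (H →L[ℂ] H)) (Ω : H)
    (t : T) : H →L[ℂ] H :=
  supportProj (localAlgebra i π t) Ω

/-- The range of the limit of the projections `F_t]` as `t → -∞`. -/
noncomputable def limitSubspace (i : T → (B₀ →⋆ₙₐ[ℂ] B)) (π : B →⋆ₙₐ[ℂ] (H →L[ℂ] H)) (Ω : H) :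
    Submodule ℂ H :=
  ⨅ t, supportSubspace (localAlgebra i π t) Ω

noncomputable instance (i : T → (B₀ →⋆ₙₐ[ℂ] B)) (π : B →⋆ₙₐ[ℂ] (H →L[ℂ] H)) (Ω : H) :
    CompleteSpace (limitSubspace i π Ω) := by
  refine IsClosed.completeSpace_coe (hs := ?_)
  rw [limitSubspace, Submodule.coe_iInf]
  exact isClosed_iInter fun t => Submodule.isClosed_topologicalClosure _

/-- `Q`, the limit of the decreasing family of projections `F_t]` as `t → -∞`, i.e. the projection
onto the intersection of their ranges; see `tendsto_filtration`. -/
noncomputable def limitProj (i : T → (B₀ →⋆ₙₐ[ℂ] B)) (π : B →⋆ₙₐ[ℂ] (H →L[ℂ] H)) (Ω : H) :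
    H →L[ℂ] H :=
  (limitSubspace i π Ω).starProjection

theorem supportSubspace_localAlgebra_mono {S : EndoSemigroup T B₀} {i : T → (B₀ →⋆ₙₐ[ℂ] B)}
    (hi : IsInductiveLimit S i) (π : B →⋆ₙₐ[ℂ] (H →L[ℂ] H)) (Ω : H) :
    Monotone fun t => supportSubspace (localAlgebra i π t) Ω := by
  intro s t hst
  refine Submodule.topologicalClosure_mono ?_
  rintro _ ⟨m, rfl⟩
  refine ⟨⟨m, vonNeumann_mono ?_ m.2⟩, rfl⟩
  rintro _ ⟨b, rfl⟩
  refine ⟨S.endo ⟨t - s, sub_nonneg.2 hst⟩ b, ?_⟩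
  have := hi.compat s ⟨t - s, sub_nonneg.2 hst⟩ b
  simp only [add_sub_cancel] at this
  simp [this]

/-- The projections `F_t]` converge strongly to `Q` as `t → -∞`. -/
theorem tendsto_filtration {S : EndoSemigroup T B₀} {i : T → (B₀ →⋆ₙₐ[ℂ] B)}
    (hi : IsInductiveLimit S i) (π : B →⋆ₙₐ[ℂ] (H →L[ℂ] H)) (Ω ξ : H) :
    Tendsto (fun t => filtration i π Ω t ξ) atBot (𝓝 (limitProj i π Ω ξ)) := by
  have hmono := supportSubspace_localAlgebra_mono hi π Ω
  have key := Submodule.starProjection_tendsto_closure_iSup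
    (fun t : Tᵒᵈ => (supportSubspace (localAlgebra i π (OrderDual.ofDual t)) Ω)ᗮ)
    (fun s t hst => Submodule.orthogonal_le (hmono (OrderDual.ofDual_le_ofDual.2 hst))) ξ
  have h1 : (⨆ t : Tᵒᵈ, (supportSubspace (localAlgebra i π (OrderDual.ofDual t)) Ω)ᗮ).topologicalClosure
      = (limitSubspace i π Ω)ᗮ := by
    rw [← Submodule.orthogonal_orthogonal_eq_closure, ← Submodule.iInf_orthogonal]
    congr 1
    simp only [Submodule.orthogonal_orthogonal]
    rfl
  have h2 := (tendsto_const_nhds (x := ξ)).sub key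
  simp only [h1, Submodule.starProjection_orthogonal'] at h2
  have h3 : Tendsto (fun t : Tᵒᵈ => filtration i π Ω (OrderDual.ofDual t) ξ) atTop
      (𝓝 (limitProj i π Ω ξ)) := by
    simpa [filtration, supportProj, limitProj] using h2
  exact h3

end Filtration

/-! ### The compressed dynamics -/

section Compressed

variable {T : Type*} [AddCommGroup T] [LinearOrder T] [IsOrderedAddMonoid T]
variable {B₀ : Type*} [NonUnitalCStarAlgebra B₀]
variable {H : Type*} [NormedAddCommGroup H] [InnerProductSpace ℂ H] [CompleteSpace H]

/-- The map `b ↦ π(b) Ω`. -/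
noncomputable def orbit (π : B₀ →⋆ₙₐ[ℂ] (H →L[ℂ] H)) (Ω : H) : B₀ →ₗ[ℂ] H where
  toFun b := π b Ω
  map_add' _ _ := by simp
  map_smul' _ _ := by simp

/-- The isometry `V_t` of the GNS space with `V_t π(b) Ω = π(λ_t(b)) Ω`. -/
noncomputable def implement (S : EndoSemigroup T B₀) (π : B₀ →⋆ₙₐ[ℂ] (H →L[ℂ] H)) (Ω : H)
    (t : {t : T // 0 ≤ t}) : H →L[ℂ] H :=
  (orbit (π.comp (S.endo t)) Ω).extendOfNorm (orbit π Ω)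

/-- For `X` in `π(B₀)''` the operator `λ_t(X) P`, where `λ_t` is the normal extension to `π(B₀)''`
of the endomorphism `λ_t` of `B₀` and `P` is the projection onto `[π(B₀)'Ω]`. It is given on
`[π(B₀)'Ω]` by `λ_t(X) m Ω = m λ_t(X) Ω = m V_t X Ω` for `m` in `π(B₀)'`, and it vanishes on the
orthogonal complement. It exists whether or not `λ_t` extends to a normal map on all of `π(B₀)''`;
if it does, then this is the product of the extension and `P`, by `inducedMul_eq`. -/
noncomputable def inducedMul (S : EndoSemigroup T B₀) (π : B₀ →⋆ₙₐ[ℂ] (H →L[ℂ] H)) (Ω : H)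
    (t : {t : T // 0 ≤ t}) (X : H →L[ℂ] H) : H →L[ℂ] H :=
  (commutantOrbit (vonNeumann π) (implement S π Ω t (X Ω))).extendOfNorm
      ((commutantOrbit (vonNeumann π) Ω).codRestrict (supportSubspace (vonNeumann π) Ω)
        fun m => apply_mem_supportSubspace m.2) ∘L
    (supportSubspace (vonNeumann π) Ω).orthogonalProjectionOnto

/-- The corner algebra `A₀ = P π(B₀)'' P`, where `P` is the support projection of the state. -/
def cornerAlgebra (π : B₀ →⋆ₙₐ[ℂ] (H →L[ℂ] H)) (Ω : H) : Set (H →L[ℂ] H) :=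
  {x | ∃ X ∈ vonNeumann π,
    x = supportProj (vonNeumann π) Ω * X * supportProj (vonNeumann π) Ω}

/-- `τ_t(x) = P λ_t(P x P) P`. -/
noncomputable def markovMap (S : EndoSemigroup T B₀) (π : B₀ →⋆ₙₐ[ℂ] (H →L[ℂ] H)) (Ω : H)
    (t : {t : T // 0 ≤ t}) (x : H →L[ℂ] H) : H →L[ℂ] H :=
  supportProj (vonNeumann π) Ω * inducedMul S π Ω t
      (supportProj (vonNeumann π) Ω * x * supportProj (vonNeumann π) Ω) *
    supportProj (vonNeumann π) Ω

/-- The vector functional `φ(x) = ⟨Ω, x Ω⟩`. -/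
noncomputable def vectorState (Ω : H) (x : H →L[ℂ] H) : ℂ := ⟪Ω, x Ω⟫_ℂ

section Properties

variable {S : EndoSemigroup T B₀} {ψ : B₀ →L[ℂ] ℂ} {π : B₀ →⋆ₙₐ[ℂ] (H →L[ℂ] H)} {Ω : H}

theorem IsGNS.inner_apply_apply (h : IsGNS ψ π Ω) (a b : B₀) :
    ⟪π a Ω, π b Ω⟫_ℂ = ψ (star a * b) := by
  rw [← h.inner_eq, map_mul, map_star, mul_apply_eq_comp,
    ContinuousLinearMap.star_eq_adjoint, ContinuousLinearMap.adjoint_inner_right]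

theorem norm_orbit_comp (h : IsGNS ψ π Ω) (hinv : ∀ t b, ψ (S.endo t b) = ψ b)
    (t : {t : T // 0 ≤ t}) (b : B₀) : ‖orbit (π.comp (S.endo t)) Ω b‖ = ‖orbit π Ω b‖ := by
  have : ⟪π (S.endo t b) Ω, π (S.endo t b) Ω⟫_ℂ = ⟪π b Ω, π b Ω⟫_ℂ := by
    rw [h.inner_apply_apply, h.inner_apply_apply, ← map_star, ← map_mul, hinv]
  rw [inner_self_eq_norm_sq_to_K, inner_self_eq_norm_sq_to_K] at this
  have h2 : ‖π (S.endo t b) Ω‖ ^ 2 = ‖π b Ω‖ ^ 2 := by exact_mod_cast this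
  exact (sq_eq_sq₀ (norm_nonneg _) (norm_nonneg _)).1 h2

theorem implement_apply (h : IsGNS ψ π Ω) (hinv : ∀ t b, ψ (S.endo t b) = ψ b)
    (t : {t : T // 0 ≤ t}) (b : B₀) :
    implement S π Ω t (π b Ω) = π (S.endo t b) Ω :=
  LinearMap.extendOfNorm_eq (f := orbit (π.comp (S.endo t)) Ω) (e := orbit π Ω) h.cyclic
    ⟨1, fun b => by rw [norm_orbit_comp h hinv, one_mul]⟩ b

theorem norm_implement_apply (h : IsGNS ψ π Ω) (hinv : ∀ t b, ψ (S.endo t b) = ψ b)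
    (t : {t : T // 0 ≤ t}) (ξ : H) : ‖implement S π Ω t ξ‖ = ‖ξ‖ := by
  refine h.cyclic.induction (P := fun ξ => ‖implement S π Ω t ξ‖ = ‖ξ‖) ?_
    (isClosed_eq (by fun_prop) (by fun_prop)) ξ
  rintro _ ⟨b, rfl⟩
  rw [implement_apply h hinv]
  exact norm_orbit_comp h hinv t b

theorem implement_intertwine (h : IsGNS ψ π Ω) (hinv : ∀ t b, ψ (S.endo t b) = ψ b)
    (t : {t : T // 0 ≤ t}) (b : B₀) :
    implement S π Ω t * π b = π (S.endo t b) * implement S π Ω t := by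
  ext ξ
  refine h.cyclic.induction
    (P := fun ξ => (implement S π Ω t * π b) ξ = (π (S.endo t b) * implement S π Ω t) ξ) ?_
    (isClosed_eq (by fun_prop) (by fun_prop)) ξ
  rintro _ ⟨a, rfl⟩
  have : π b (π a Ω) = π (b * a) Ω := by simp
  simp only [mul_apply_eq_comp]
  rw [this, implement_apply h hinv, implement_apply h hinv]
  simp

theorem inner_implement (h : IsGNS ψ π Ω) (hinv : ∀ t b, ψ (S.endo t b) = ψ b)
    (t : {t : T // 0 ≤ t}) (ξ η : H) :
    ⟪implement S π Ω t ξ, implement S π Ω t η⟫_ℂ = ⟪ξ, η⟫_ℂ :=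
  LinearIsometry.inner_map_map ⟨(implement S π Ω t).toLinearMap, norm_implement_apply h hinv t⟩ ξ η

theorem implement_self (h : IsGNS ψ π Ω) (hinv : ∀ t b, ψ (S.endo t b) = ψ b)
    (t : {t : T // 0 ≤ t}) : implement S π Ω t Ω = Ω := by
  have hΩ := h.norm_eq_one
  have key : ⟪Ω, implement S π Ω t Ω⟫_ℂ = 1 := by
    have hcl : ∀ ξ, ⟪Ω, implement S π Ω t ξ⟫_ℂ = ⟪Ω, ξ⟫_ℂ := by
      intro ξ
      refine h.cyclic.induction
        (P := fun ξ => ⟪Ω, implement S π Ω t ξ⟫_ℂ = ⟪Ω, ξ⟫_ℂ) ?_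
        (isClosed_eq (by fun_prop) (by fun_prop)) ξ
      rintro _ ⟨b, rfl⟩
      rw [implement_apply h hinv, h.inner_eq, h.inner_eq, hinv]
    rw [hcl, inner_self_eq_norm_sq_to_K, hΩ]
    simp
  exact ((inner_eq_one_iff_of_norm_eq_one hΩ (by rw [norm_implement_apply h hinv, hΩ])).1 key).symm

theorem star_implement_mul_mul_mem (h : IsGNS ψ π Ω) (hinv : ∀ t b, ψ (S.endo t b) = ψ b)
    (t : {t : T // 0 ≤ t}) {m : H →L[ℂ] H} (hm : m ∈ (vonNeumann π).commutant) :
    star (implement S π Ω t) * m * implement S π Ω t ∈ (vonNeumann π).commutant := by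
  rw [mem_commutant_vonNeumann] at hm ⊢
  intro b
  have h1 := implement_intertwine h hinv t b
  have h2 := congrArg star (implement_intertwine h hinv t (star b))
  simp only [star_mul, map_star, star_star] at h2
  rw [← mul_assoc, ← mul_assoc, h2, mul_assoc _ _ m, hm, mul_assoc _ _ (π b), h1]
  simp only [mul_assoc]

theorem norm_commutant_apply_le (h : IsGNS ψ π Ω) (hinv : ∀ t b, ψ (S.endo t b) = ψ b)
    (t : {t : T // 0 ≤ t}) {X m : H →L[ℂ] H} (hX : X ∈ vonNeumann π)
    (hm : m ∈ (vonNeumann π).commutant) :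
    ‖m (implement S π Ω t (X Ω))‖ ≤ ‖X‖ * ‖m Ω‖ := by
  set V := implement S π Ω t with hV
  set A := star V * (star m * m) * V with hA
  have hAmem : A ∈ (vonNeumann π).commutant :=
    star_implement_mul_mul_mem h hinv t (mul_mem (star_mem hm) hm)
  have hAX : X * A = A * X := VonNeumannAlgebra.mem_commutant_iff.1 hAmem X hX
  have hAX' : star X * A = A * star X :=
    VonNeumannAlgebra.mem_commutant_iff.1 hAmem _ (star_mem hX)
  have hAeq : A = star (m * V) * (m * V) := by simp [hA, mul_assoc]
  have hA0 : 0 ≤ A := hAeq ▸ star_mul_self_nonneg _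
  have hX0 : 0 ≤ algebraMap ℝ (H →L[ℂ] H) (‖X‖ ^ 2) - star X * X :=
    sub_nonneg.2 CStarAlgebra.star_mul_le_algebraMap_norm_sq
  have hcomm : Commute A (algebraMap ℝ (H →L[ℂ] H) (‖X‖ ^ 2) - star X * X) := by
    refine Commute.sub_right (Algebra.commutes _ _).symm ?_
    change A * (star X * X) = star X * X * A
    rw [← mul_assoc, ← hAX', mul_assoc, ← hAX, mul_assoc]
  have hpos := Commute.mul_nonneg hA0 hX0 hcomm
  rw [ContinuousLinearMap.nonneg_iff_isPositive] at hpos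
  have h3 := hpos.re_inner_nonneg_right Ω
  have e1 : ∀ ξ, ⟪ξ, A ξ⟫_ℂ = (‖m (V ξ)‖ ^ 2 : ℝ) := by
    intro ξ
    rw [hAeq, mul_apply_eq_comp, ContinuousLinearMap.star_eq_adjoint,
      ContinuousLinearMap.adjoint_inner_right, inner_self_eq_norm_sq_to_K]
    simp
  have e2 : ⟪Ω, (A * (algebraMap ℝ (H →L[ℂ] H) (‖X‖ ^ 2) - star X * X)) Ω⟫_ℂ
      = ((‖X‖ ^ 2 * ‖m (V Ω)‖ ^ 2 - ‖m (V (X Ω))‖ ^ 2 : ℝ) : ℂ) := by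
    have : A * (algebraMap ℝ (H →L[ℂ] H) (‖X‖ ^ 2) - star X * X)
        = (‖X‖ ^ 2) • A - star X * (A * X) := by
      rw [mul_sub, ← Algebra.commutes, ← mul_assoc A, ← hAX', mul_assoc, Algebra.smul_def]
    rw [this, sub_apply, inner_sub_right, mul_apply_eq_comp,
      ContinuousLinearMap.star_eq_adjoint, ContinuousLinearMap.adjoint_inner_right,
      mul_apply_eq_comp, e1, smul_apply, inner_smul_right_eq_smul, e1]
    push_cast
    simp
  rw [e2] at h3
  simp only [RCLike.re_to_complex, Complex.ofReal_re] at h3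
  rw [hV, implement_self h hinv] at h3
  rw [← abs_of_nonneg (norm_nonneg (m (V (X Ω)))), ← abs_of_nonneg
    (mul_nonneg (norm_nonneg X) (norm_nonneg (m Ω)))]
  refine sq_le_sq.1 ?_
  rw [mul_pow]
  linarith

/-- The defining property of `λ_t(X) P` on `[π(B₀)'Ω]`. -/
theorem inducedMul_apply_orbit (h : IsGNS ψ π Ω) (hinv : ∀ t b, ψ (S.endo t b) = ψ b)
    (t : {t : T // 0 ≤ t}) {X m : H →L[ℂ] H} (hX : X ∈ vonNeumann π)
    (hm : m ∈ (vonNeumann π).commutant) :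
    inducedMul S π Ω t X (m Ω) = m (implement S π Ω t (X Ω)) := by
  have hd : DenseRange ((commutantOrbit (vonNeumann π) Ω).codRestrict
      (supportSubspace (vonNeumann π) Ω) fun m => apply_mem_supportSubspace m.2) := by
    rw [DenseRange, Subtype.dense_iff]
    intro ξ hξ
    refine closure_mono ?_ hξ
    rintro _ ⟨m, rfl⟩
    exact ⟨_, ⟨m, rfl⟩, rfl⟩
  have := LinearMap.extendOfNorm_eq
    (f := commutantOrbit (vonNeumann π) (implement S π Ω t (X Ω))) hd
    ⟨‖X‖, fun m => norm_commutant_apply_le h hinv t hX m.2⟩ ⟨m, hm⟩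
  rw [inducedMul, ContinuousLinearMap.comp_apply]
  have hp : (supportSubspace (vonNeumann π) Ω).orthogonalProjectionOnto (m Ω)
      = ⟨m Ω, apply_mem_supportSubspace hm⟩ :=
    Submodule.orthogonalProjectionOnto_mem_subspace_eq_self
      (⟨m Ω, apply_mem_supportSubspace hm⟩ : supportSubspace (vonNeumann π) Ω)
  rw [hp]
  exact this

theorem inducedMul_mul_supportProj (t : {t : T // 0 ≤ t}) (X : H →L[ℂ] H) :
    inducedMul S π Ω t X * supportProj (vonNeumann π) Ω = inducedMul S π Ω t X := by
  ext ξ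
  simp [inducedMul, supportProj, Submodule.orthogonalProjectionOnto_starProjection_of_le le_rfl]

/-- Two operators agree on `[M'Ω]` if they agree on `M'Ω`. -/
theorem mul_supportProj_eq {M : VonNeumannAlgebra H} {C D : H →L[ℂ] H}
    (hCD : ∀ m ∈ M.commutant, C (m Ω) = D (m Ω)) :
    C * supportProj M Ω = D * supportProj M Ω := by
  ext ξ
  have h : supportSubspace M Ω ≤ LinearMap.eqLocus (C : H →ₗ[ℂ] H) (D : H →ₗ[ℂ] H) := by
    refine Submodule.topologicalClosure_minimal _ ?_ (isClosed_eq C.continuous D.continuous)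
    rintro _ ⟨m, rfl⟩
    exact hCD m m.2
  exact h (Submodule.starProjection_apply_mem _ ξ)

/-- If `Λ X` is an operator in `π(B₀)''` with `Λ X V_t = V_t X`, then `inducedMul` is `Λ X P`. In
particular, this applies to every normal extension `Λ` of `λ_t` to `π(B₀)''`: both sides of
`Λ X V_t = V_t X` are then normal in `X` and they agree for `X = π b`. -/
theorem inducedMul_eq (h : IsGNS ψ π Ω) (hinv : ∀ t b, ψ (S.endo t b) = ψ b)
    (t : {t : T // 0 ≤ t}) {X Y : H →L[ℂ] H} (hX : X ∈ vonNeumann π) (hY : Y ∈ vonNeumann π)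
    (hXY : Y * implement S π Ω t = implement S π Ω t * X) :
    inducedMul S π Ω t X = Y * supportProj (vonNeumann π) Ω := by
  rw [← inducedMul_mul_supportProj]
  refine mul_supportProj_eq fun m hm => ?_
  have e : implement S π Ω t (X Ω) = Y (implement S π Ω t Ω) := (DFunLike.congr_fun hXY Ω).symm
  rw [inducedMul_apply_orbit h hinv t hX hm, e, implement_self h hinv]
  exact (DFunLike.congr_fun (VonNeumannAlgebra.mem_commutant_iff.1 hm Y hY) Ω).symm

theorem inducedMul_map (h : IsGNS ψ π Ω) (hinv : ∀ t b, ψ (S.endo t b) = ψ b)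
    (t : {t : T // 0 ≤ t}) (b : B₀) :
    inducedMul S π Ω t (π b) = π (S.endo t b) * supportProj (vonNeumann π) Ω :=
  inducedMul_eq h hinv t (map_mem_vonNeumann _ _) (map_mem_vonNeumann _ _)
    (implement_intertwine h hinv t b).symm

theorem inducedMul_mem (h : IsGNS ψ π Ω) (hinv : ∀ t b, ψ (S.endo t b) = ψ b)
    (t : {t : T // 0 ≤ t}) {X : H →L[ℂ] H} (hX : X ∈ vonNeumann π) :
    inducedMul S π Ω t X ∈ vonNeumann π := by
  rw [← VonNeumannAlgebra.commutant_commutant (vonNeumann π), VonNeumannAlgebra.mem_commutant_iff]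
  intro n hn
  have hP : n * supportProj (vonNeumann π) Ω = supportProj (vonNeumann π) Ω * n :=
    (VonNeumannAlgebra.mem_commutant_iff.1 hn _ (supportProj_mem _ _)).symm
  rw [← inducedMul_mul_supportProj, mul_assoc _ _ n, ← hP, ← mul_assoc, ← mul_assoc]
  refine mul_supportProj_eq fun m hm => ?_
  have hnm : (n * m) ∈ (vonNeumann π).commutant := mul_mem hn hm
  have := inducedMul_apply_orbit h hinv t hX hnm
  simp only [mul_apply_eq_comp] at this ⊢
  rw [this, inducedMul_apply_orbit h hinv t hX hm]

/-- `τ_t` maps `A₀` into `A₀`. -/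
theorem markovMap_mem (h : IsGNS ψ π Ω) (hinv : ∀ t b, ψ (S.endo t b) = ψ b)
    (t : {t : T // 0 ≤ t}) {x : H →L[ℂ] H} (hx : x ∈ cornerAlgebra π Ω) :
    markovMap S π Ω t x ∈ cornerAlgebra π Ω := by
  obtain ⟨X, hX, rfl⟩ := hx
  have hP := supportProj_mem (vonNeumann π) Ω
  exact ⟨_, inducedMul_mem h hinv t (mul_mem (mul_mem hP (mul_mem (mul_mem hP hX) hP)) hP), rfl⟩

/-- `τ_t(P π(b) P) = P π(λ_t(b)) P`. -/
theorem markovMap_map (h : IsGNS ψ π Ω) (hinv : ∀ t b, ψ (S.endo t b) = ψ b)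
    (t : {t : T // 0 ≤ t}) (b : B₀) :
    markovMap S π Ω t (supportProj (vonNeumann π) Ω * π b * supportProj (vonNeumann π) Ω) =
      supportProj (vonNeumann π) Ω * π (S.endo t b) * supportProj (vonNeumann π) Ω := by
  set P := supportProj (vonNeumann π) Ω with hPdef
  have hP : P ∈ vonNeumann π := supportProj_mem _ _
  have hPP : P * P = P := (isStarProjection_supportProj (vonNeumann π) Ω).isIdempotentElem
  have hPs : star P = P := (isStarProjection_supportProj (vonNeumann π) Ω).isSelfAdjoint
  have hVP : P * implement S π Ω t * P = P * implement S π Ω t := by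
    have : P * star (implement S π Ω t) * P = star (implement S π Ω t) * P := by
      refine mul_supportProj_eq fun m hm => ?_
      have h1 := supportProj_apply_orbit (Ω := Ω) (star_implement_mul_mul_mem h hinv t hm)
      simpa [implement_self h hinv, hPdef] using h1
    have h2 := congrArg star this
    simpa [hPs, mul_assoc] using h2
  have hmem : P * (P * π b * P) * P ∈ vonNeumann π :=
    mul_mem (mul_mem hP (mul_mem (mul_mem hP (map_mem_vonNeumann _ _)) hP)) hP
  rw [markovMap, ← hPdef]
  refine mul_supportProj_eq fun m hm => ?_
  have hmP : P * m = m * P := VonNeumannAlgebra.mem_commutant_iff.1 hm P hP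
  have hmπ := VonNeumannAlgebra.mem_commutant_iff.1 hm _ (map_mem_vonNeumann π (S.endo t b))
  rw [mul_apply_eq_comp, inducedMul_apply_orbit h hinv t hmem hm]
  have hX : (P * (P * π b * P) * P) Ω = P (π b Ω) := by
    have hPΩ : P Ω = Ω := supportProj_apply_self _ _
    have hPP' : ∀ ξ, P (P ξ) = P ξ := fun ξ => DFunLike.congr_fun hPP ξ
    simp [hPΩ, hPP']
  have e1 : P (m (implement S π Ω t (P (π b Ω)))) = m ((P * implement S π Ω t * P) (π b Ω)) :=
    DFunLike.congr_fun hmP _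
  have e2 : P (π (S.endo t b) (m Ω)) = m (P (π (S.endo t b) Ω)) := by
    have a1 : π (S.endo t b) (m Ω) = m (π (S.endo t b) Ω) := DFunLike.congr_fun hmπ Ω
    rw [a1]
    exact DFunLike.congr_fun hmP _
  rw [hX, e1, hVP, mul_apply_eq_comp, mul_apply_eq_comp, implement_apply h hinv, e2]

end Properties

end Compressed

/-! ### Existence of the inductive limit, of the extended state and of the GNS triple

These are not used in the definitions above; they show that the objects characterized by
`IsInductiveLimit` and `IsGNS` exist. -/

section CompletionAlgebra

set_option linter.unusedSectionVars false

open UniformSpace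

/-- The extension of a bounded linear map to the completion. -/
noncomputable def complExt {E F : Type*} [SeminormedAddCommGroup E] [NormedSpace ℂ E]
    [NormedAddCommGroup F] [NormedSpace ℂ F] [CompleteSpace F] (f : E →ₗ[ℂ] F) :
    Completion E →L[ℂ] F :=
  f.extendOfNorm (Completion.toComplₗᵢ (𝕜 := ℂ) (E := E)).toLinearMap

theorem complExt_coe {E F : Type*} [SeminormedAddCommGroup E] [NormedSpace ℂ E]
    [NormedAddCommGroup F] [NormedSpace ℂ F] [CompleteSpace F] {f : E →ₗ[ℂ] F} {C : ℝ}
    (hf : ∀ x, ‖f x‖ ≤ C * ‖x‖) (x : E) : complExt f (x : Completion E) = f x :=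
  LinearMap.extendOfNorm_eq (e := (Completion.toComplₗᵢ (𝕜 := ℂ) (E := E)).toLinearMap)
    Completion.denseRange_coe ⟨C, fun x => by simpa using hf x⟩ x

variable {A : Type*} [NonUnitalSeminormedRing A] [StarRing A] [NormedSpace ℂ A]
  [IsScalarTower ℂ A A] [SMulCommClass ℂ A A] [StarModule ℂ A] [NormedStarGroup A]

/-- Left multiplication by an element of `A` on the completion. -/
noncomputable def complMulLeft : A →ₗ[ℂ] (Completion A →L[ℂ] Completion A) where
  toFun a := (ContinuousLinearMap.mul ℂ A a).completion
  map_add' a b := by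
    ext x
    induction x using Completion.induction_on with
    | hp => exact isClosed_eq (ContinuousLinearMap.continuous _) (ContinuousLinearMap.continuous _)
    | ih x =>
      rw [add_apply]
      simp only [ContinuousLinearMap.completion_apply_coe, ContinuousLinearMap.mul_apply',
        add_mul, Completion.coe_add]
  map_smul' c a := by
    ext x
    induction x using Completion.induction_on with
    | hp => exact isClosed_eq (ContinuousLinearMap.continuous _) (ContinuousLinearMap.continuous _)
    | ih x =>
      rw [smul_apply]
      simp only [ContinuousLinearMap.completion_apply_coe, ContinuousLinearMap.mul_apply',
        smul_mul_assoc, Completion.coe_smul, RingHom.id_apply]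

/-- The multiplication of the completion as a bilinear map. -/
noncomputable def complMul : Completion A →L[ℂ] Completion A →L[ℂ] Completion A :=
  complExt (E := A) (F := Completion A →L[ℂ] Completion A) complMulLeft

theorem norm_complMulLeft_le (a : A) : ‖complMulLeft a‖ ≤ 1 * ‖a‖ := by
  refine ContinuousLinearMap.opNorm_le_bound _ (by positivity) fun x => ?_
  induction x using Completion.induction_on with
  | hp =>
    exact isClosed_le (ContinuousLinearMap.continuous _).norm (continuous_const.mul continuous_norm)
  | ih x => simpa [complMulLeft] using norm_mul_le a x

theorem complMul_coe (a : A) : complMul (a : Completion A) = complMulLeft a :=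
  complExt_coe (E := A) (F := Completion A →L[ℂ] Completion A) norm_complMulLeft_le a

theorem complMul_coe_coe (a b : A) :
    complMul (a : Completion A) (b : Completion A) = ((a * b : A) : Completion A) := by
  rw [complMul_coe]; simp [complMulLeft]

/-- The involution of the completion. -/
noncomputable def complStar : Completion A →L⋆[ℂ] Completion A :=
  (LinearMap.mk (σ := starRingEnd ℂ) (M := A) (M₂ := Completion A)
    ⟨fun a => ((star a : A) : Completion A), fun a b => by simp [Completion.coe_add]⟩
    (fun c a => by simp [Completion.coe_smul])).extendOfNorm
    (Completion.toComplₗᵢ (𝕜 := ℂ) (E := A)).toLinearMap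

theorem complStar_coe (a : A) : complStar (a : Completion A) = ((star a : A) : Completion A) :=
  LinearMap.extendOfNorm_eq (e := (Completion.toComplₗᵢ (𝕜 := ℂ) (E := A)).toLinearMap)
    Completion.denseRange_coe ⟨1, fun a => by simp⟩ a

/-- The completion of a C⋆-seminormed algebra is a C⋆-algebra. -/
@[reducible] noncomputable def complCStar (hA : ∀ a : A, ‖a‖ * ‖a‖ ≤ ‖star a * a‖) :
    NonUnitalCStarAlgebra (Completion A) :=
  letI : NonUnitalNormedRing (Completion A) :=
    { (inferInstance : NormedAddCommGroup (Completion A)) with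
      mul := fun x y => complMul x y
      left_distrib := fun x y z => map_add (complMul x) y z
      right_distrib := fun x y z => by
        change complMul (x + y) z = complMul x z + complMul y z
        simp
      zero_mul := fun x => by
        change complMul 0 x = 0
        simp
      mul_zero := fun x => map_zero (complMul x)
      mul_assoc := fun x y z => by
        change complMul (complMul x y) z = complMul x (complMul y z)
        induction x, y, z using Completion.induction_on₃ with
        | hp => apply isClosed_eq <;> fun_prop
        | ih x y z => simp only [complMul_coe_coe, mul_assoc]
      norm_mul_le := fun x y => by
        change ‖complMul x y‖ ≤ ‖x‖ * ‖y‖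
        induction x, y using Completion.induction_on₂ with
        | hp => apply isClosed_le <;> fun_prop
        | ih x y => simpa only [complMul_coe_coe, Completion.norm_coe] using norm_mul_le x y }
  letI : StarRing (Completion A) :=
    { star := fun x => complStar x
      star_involutive := fun x => by
        change complStar (complStar x) = x
        induction x using Completion.induction_on with
        | hp => apply isClosed_eq <;> fun_prop
        | ih x => simp only [complStar_coe, star_star]
      star_mul := fun x y => by
        change complStar (complMul x y) = complMul (complStar y) (complStar x)
        induction x, y using Completion.induction_on₂ with
        | hp => apply isClosed_eq <;> fun_prop
        | ih x y => simp only [complMul_coe_coe, complStar_coe, star_mul]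
      star_add := fun x y => map_add complStar x y }
  { (inferInstance : NormedSpace ℂ (Completion A)) with
    norm_mul_self_le := fun x => by
      change ‖x‖ * ‖x‖ ≤ ‖complMul (complStar x) x‖
      induction x using Completion.induction_on with
      | hp => apply isClosed_le <;> fun_prop
      | ih x => simpa only [complStar_coe, complMul_coe_coe, Completion.norm_coe] using hA x
    smul_assoc := fun c x y => by
      change complMul (c • x) y = c • complMul x y
      simp
    smul_comm := fun c x y => by
      change c • complMul x y = complMul x (c • y)
      simp
    star_smul := fun c x => map_smulₛₗ complStar c x
    complete := CompleteSpace.complete }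

end CompletionAlgebra

section Existence

open UniformSpace

variable {T : Type*} [AddCommGroup T] [LinearOrder T] [IsOrderedAddMonoid T]
variable {B₀ : Type*} [NonUnitalCStarAlgebra B₀]

/-- The function `f` represents the element `b` of the copy of `B₀` at `s`. -/
def IsTail (S : EndoSemigroup T B₀) (f : T → B₀) (s : T) (b : B₀) : Prop :=
  ∀ t : {t : T // 0 ≤ t}, f (s - t) = S.endo t b

theorem IsTail.raise {S : EndoSemigroup T B₀} {f : T → B₀} {s : T} {b : B₀} (h : IsTail S f s b)
    (r : {t : T // 0 ≤ t}) : IsTail S f (s - r) (S.endo r b) := by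
  intro t
  rw [← S.endo_add, add_comm t r, ← h (r + t), sub_sub]
  rfl

theorem IsTail.raise_to {S : EndoSemigroup T B₀} {f : T → B₀} {s s' : T} {b : B₀}
    (h : IsTail S f s b) (hs : s' ≤ s) : IsTail S f s' (S.endo ⟨s - s', sub_nonneg.2 hs⟩ b) := by
  have := h.raise ⟨s - s', sub_nonneg.2 hs⟩
  simpa using this

theorem IsTail.self {S : EndoSemigroup T B₀} {f : T → B₀} {s : T} {b : B₀} (h : IsTail S f s b) :
    f s = b := by
  have := h 0
  rw [S.endo_zero] at this
  simpa using this

/-- The functions that represent an element of some copy of `B₀`. -/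
def preLimit (S : EndoSemigroup T B₀) : NonUnitalStarSubalgebra ℂ (T → B₀) where
  carrier := {f | ∃ s b, IsTail S f s b}
  add_mem' := by
    rintro f g ⟨s, b, hf⟩ ⟨s', b', hg⟩
    have h1 := hf.raise_to (min_le_left s s')
    have h2 := hg.raise_to (min_le_right s s')
    exact ⟨min s s', _ + _, fun t => by rw [Pi.add_apply, h1 t, h2 t, map_add]⟩
  zero_mem' := ⟨0, 0, fun t => by simp⟩
  mul_mem' := by
    rintro f g ⟨s, b, hf⟩ ⟨s', b', hg⟩
    have h1 := hf.raise_to (min_le_left s s')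
    have h2 := hg.raise_to (min_le_right s s')
    exact ⟨min s s', _ * _, fun t => by rw [Pi.mul_apply, h1 t, h2 t, map_mul]⟩
  smul_mem' := by
    rintro c f ⟨s, b, hf⟩
    exact ⟨s, c • b, fun t => by rw [Pi.smul_apply, hf t, map_smul]⟩
  star_mem' := by
    rintro f ⟨s, b, hf⟩
    exact ⟨s, star b, fun t => by rw [Pi.star_apply, hf t, map_star]⟩

/-- The functions that represent an element of some copy of `B₀`, as a seminormed algebra. -/
def PreLimit (S : EndoSemigroup T B₀) : Type _ := preLimit S

namespace PreLimit

variable {S : EndoSemigroup T B₀}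

instance : NonUnitalRing (PreLimit S) := inferInstanceAs (NonUnitalRing (preLimit S))
instance : StarRing (PreLimit S) := inferInstanceAs (StarRing (preLimit S))
instance : Module ℂ (PreLimit S) := inferInstanceAs (Module ℂ (preLimit S))
instance : IsScalarTower ℂ (PreLimit S) (PreLimit S) :=
  inferInstanceAs (IsScalarTower ℂ (preLimit S) (preLimit S))
instance : SMulCommClass ℂ (PreLimit S) (PreLimit S) :=
  inferInstanceAs (SMulCommClass ℂ (preLimit S) (preLimit S))
instance : StarModule ℂ (PreLimit S) := inferInstanceAs (StarModule ℂ (preLimit S))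

/-- The value at `t`. -/
def val (f : PreLimit S) (t : T) : B₀ := (show preLimit S from f).1 t

@[simp] theorem val_add (f g : PreLimit S) (t : T) : (f + g).val t = f.val t + g.val t := rfl
@[simp] theorem val_mul (f g : PreLimit S) (t : T) : (f * g).val t = f.val t * g.val t := rfl
@[simp] theorem val_smul (c : ℂ) (f : PreLimit S) (t : T) : (c • f).val t = c • f.val t := rfl
@[simp] theorem val_star (f : PreLimit S) (t : T) : (star f).val t = star (f.val t) := rfl

/-- A property that is invariant under the endomorphisms is eventually constant. -/
theorem eventually_eq {α : Type*} (F : B₀ → α) (hF : ∀ t b, F (S.endo t b) = F b)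
    (f : PreLimit S) : ∃ c, ∀ᶠ t in atBot, F (f.val t) = c := by
  obtain ⟨s, b, h⟩ := (show preLimit S from f).2
  refine ⟨F b, (eventually_le_atBot s).mono fun t ht => ?_⟩
  have := (IsTail.raise_to h ht).self
  rw [val, this, hF]

/-- The eventual value of an invariant property. -/
noncomputable def evLim {α : Type*} (F : B₀ → α) (hF : ∀ t b, F (S.endo t b) = F b)
    (f : PreLimit S) : α := (eventually_eq F hF f).choose

theorem evLim_spec {α : Type*} (F : B₀ → α) (hF : ∀ t b, F (S.endo t b) = F b)
    (f : PreLimit S) : ∀ᶠ t in atBot, F (f.val t) = evLim F hF f := (eventually_eq F hF f).choose_spec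

theorem norm_endo (t : {t : T // 0 ≤ t}) (b : B₀) : ‖S.endo t b‖ = ‖b‖ :=
  NonUnitalStarAlgHom.norm_map (S.endo t) (S.endo_injective t) b

noncomputable instance : Norm (PreLimit S) := ⟨evLim (fun b => ‖b‖) norm_endo⟩

theorem norm_spec (f : PreLimit S) : ∀ᶠ t in atBot, ‖f.val t‖ = ‖f‖ := evLim_spec _ norm_endo f

theorem core : SeminormedSpace.Core ℂ (PreLimit S) where
  norm_nonneg f := by
    obtain ⟨t, ht⟩ := (norm_spec f).exists
    exact ht ▸ norm_nonneg _
  norm_smul c f := by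
    obtain ⟨t, h1, h2⟩ := ((norm_spec (c • f)).and (norm_spec f)).exists
    rw [← h1, ← h2, val_smul, norm_smul]
  norm_triangle f g := by
    obtain ⟨t, h1, h2, h3⟩ := ((norm_spec (f + g)).and ((norm_spec f).and (norm_spec g))).exists
    rw [← h1, ← h2, ← h3, val_add]
    exact norm_add_le _ _

noncomputable instance : SeminormedAddCommGroup (PreLimit S) :=
  SeminormedAddCommGroup.ofCore (𝕜 := ℂ) core

noncomputable instance : NonUnitalSeminormedRing (PreLimit S) :=
  { (inferInstance : SeminormedAddCommGroup (PreLimit S)),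
    (inferInstance : NonUnitalRing (PreLimit S)) with
    norm_mul_le := fun f g => by
      obtain ⟨t, h1, h2, h3⟩ := ((norm_spec (f * g)).and ((norm_spec f).and (norm_spec g))).exists
      rw [← h1, ← h2, ← h3, val_mul]
      exact norm_mul_le _ _ }

noncomputable instance : NormedSpace ℂ (PreLimit S) where
  norm_smul_le c f := (core.norm_smul c f).le

instance : NormedStarGroup (PreLimit S) where
  norm_star_le f := by
    obtain ⟨t, h1, h2⟩ := ((norm_spec (star f)).and (norm_spec f)).exists
    rw [← h1, ← h2, val_star, norm_star]

theorem norm_star_mul (f : PreLimit S) : ‖f‖ * ‖f‖ ≤ ‖star f * f‖ := by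
  obtain ⟨t, h1, h2⟩ := ((norm_spec (star f * f)).and (norm_spec f)).exists
  rw [← h1, ← h2, val_mul, val_star, CStarRing.norm_star_mul_self]

/-- The element of the copy of `B₀` at `s` given by `b`. -/
noncomputable def of (S : EndoSemigroup T B₀) (s : T) (b : B₀) : PreLimit S :=
  (⟨fun t => if h : 0 ≤ s - t then S.endo ⟨s - t, h⟩ b else 0,
    s, b, fun t => by simp [t.2]⟩ : preLimit S)

theorem val_of (s : T) (b : B₀) (t : T) :
    (of S s b).val t = if h : 0 ≤ s - t then S.endo ⟨s - t, h⟩ b else 0 := rfl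

theorem ext {f g : PreLimit S} (h : ∀ t, f.val t = g.val t) : f = g :=
  Subtype.ext (funext h)

theorem coe_eq_of_eventually {f g : PreLimit S} (h : ∀ᶠ t in atBot, f.val t = g.val t) :
    (f : Completion (PreLimit S)) = g := by
  rw [← sub_eq_zero, ← Completion.coe_sub, ← norm_eq_zero, Completion.norm_coe]
  obtain ⟨t, h1, h2⟩ := (h.and (norm_spec (f - g))).exists
  rw [← h2, sub_eq_add_neg, val_add, h1, ← val_add, ← sub_eq_add_neg, sub_self]
  exact norm_zero

end PreLimit

/-- The inductive limit C⋆-algebra. -/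
def Limit (S : EndoSemigroup T B₀) : Type _ := Completion (PreLimit S)

noncomputable instance (S : EndoSemigroup T B₀) : NonUnitalCStarAlgebra (Limit S) :=
  complCStar PreLimit.norm_star_mul

/-- The embeddings of `B₀` into the inductive limit. -/
noncomputable def Limit.emb (S : EndoSemigroup T B₀) (s : T) : B₀ →⋆ₙₐ[ℂ] Limit S where
  toFun b := (PreLimit.of S s b : Completion (PreLimit S))
  map_smul' c b := by
    refine (congrArg _ (PreLimit.ext fun t => ?_)).trans (Completion.coe_smul c (PreLimit.of S s b))
    simp only [PreLimit.val_of, PreLimit.val_smul]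
    split_ifs
    · exact map_smul _ _ _
    · exact (smul_zero c).symm
  map_zero' := by
    refine (congrArg _ (PreLimit.ext fun t => ?_)).trans Completion.coe_zero
    simp only [PreLimit.val_of]
    split_ifs
    · exact map_zero _
    · rfl
  map_add' a b := by
    refine (congrArg _ (PreLimit.ext fun t => ?_)).trans (Completion.coe_add _ _)
    simp only [PreLimit.val_of, PreLimit.val_add]
    split_ifs <;> simp
  map_mul' a b := by
    refine (congrArg _ (PreLimit.ext fun t => ?_)).trans (complMul_coe_coe _ _).symm
    simp only [PreLimit.val_of, PreLimit.val_mul]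
    split_ifs <;> simp
  map_star' a := by
    refine (congrArg _ (PreLimit.ext fun t => ?_)).trans (complStar_coe _).symm
    simp only [PreLimit.val_of, PreLimit.val_star]
    split_ifs
    · exact map_star _ _
    · exact (star_zero _).symm

theorem Limit.norm_emb (S : EndoSemigroup T B₀) (s : T) (b : B₀) : ‖Limit.emb S s b‖ = ‖b‖ := by
  change ‖(PreLimit.of S s b : Completion (PreLimit S))‖ = ‖b‖
  rw [Completion.norm_coe]
  obtain ⟨t, h1, h2⟩ := ((PreLimit.norm_spec (PreLimit.of S s b)).and (eventually_le_atBot s)).exists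
  rw [← h1, PreLimit.val_of, dif_pos (sub_nonneg.2 h2), PreLimit.norm_endo]

/-- The inductive limit exists. -/
theorem Limit.isInductiveLimit (S : EndoSemigroup T B₀) : IsInductiveLimit S (Limit.emb S) where
  injective s := by
    rw [injective_iff_map_eq_zero]
    intro b hb
    rw [← norm_eq_zero, ← Limit.norm_emb S s b, hb, norm_zero]
  compat s t b := by
    change (PreLimit.of S (s + t) b : Completion (PreLimit S)) = PreLimit.of S s (S.endo t b)
    refine PreLimit.coe_eq_of_eventually ((eventually_le_atBot s).mono fun r hr => ?_)
    have h1 : 0 ≤ s + t - r := sub_nonneg.2 (hr.trans (le_add_of_nonneg_right t.2))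
    have h2 : 0 ≤ s - r := sub_nonneg.2 hr
    rw [PreLimit.val_of, PreLimit.val_of, dif_pos h1, dif_pos h2, ← S.endo_add]
    congr 2
    apply Subtype.ext
    simp [add_sub_right_comm]
  dense := by
    refine Set.eq_univ_of_univ_subset fun x _ => ?_
    refine closure_mono ?_ (Completion.denseRange_coe (α := PreLimit S) x)
    rintro _ ⟨f, rfl⟩
    obtain ⟨s, b, h⟩ := (show preLimit S from f).2
    refine Set.mem_iUnion.2 ⟨s, b, ?_⟩
    change (PreLimit.of S s b : Completion (PreLimit S)) = f
    refine PreLimit.coe_eq_of_eventually ((eventually_le_atBot s).mono fun r hr => ?_)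
    rw [PreLimit.val_of, dif_pos (sub_nonneg.2 hr)]
    exact (IsTail.raise_to h hr).self.symm

end Existence

section StateExtension

open UniformSpace

variable {T : Type*} [AddCommGroup T] [LinearOrder T] [IsOrderedAddMonoid T]
variable {B₀ : Type*} [NonUnitalCStarAlgebra B₀]

/-- An invariant state extends to the inductive limit. -/
theorem Limit.exists_state (S : EndoSemigroup T B₀) {ψ : B₀ →L[ℂ] ℂ} (hψ : IsState ψ)
    (hinv : ∀ t b, ψ (S.endo t b) = ψ b) :
    ∃ ψ' : Limit S →L[ℂ] ℂ, IsState ψ' ∧ ∀ t b, ψ' (Limit.emb S t b) = ψ b := by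
  let L : PreLimit S →ₗ[ℂ] ℂ :=
    { toFun := PreLimit.evLim ψ hinv
      map_add' := fun f g => by
        obtain ⟨t, h1, h2, h3⟩ := ((PreLimit.evLim_spec ψ hinv (f + g)).and
          ((PreLimit.evLim_spec ψ hinv f).and (PreLimit.evLim_spec ψ hinv g))).exists
        rw [← h1, ← h2, ← h3, PreLimit.val_add, map_add]
      map_smul' := fun c f => by
        obtain ⟨t, h1, h2⟩ := ((PreLimit.evLim_spec ψ hinv (c • f)).and
          (PreLimit.evLim_spec ψ hinv f)).exists
        rw [← h1, ← h2, PreLimit.val_smul, map_smul, RingHom.id_apply] }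
  have hL : ∀ f, ‖L f‖ ≤ 1 * ‖f‖ := fun f => by
    obtain ⟨t, h1, h2⟩ := ((PreLimit.evLim_spec ψ hinv f).and (PreLimit.norm_spec f)).exists
    change ‖PreLimit.evLim ψ hinv f‖ ≤ _
    rw [← h1, ← h2, ← hψ.norm_eq_one]
    exact ψ.le_opNorm _
  let ψ' : Limit S →L[ℂ] ℂ := (complExt L : Completion (PreLimit S) →L[ℂ] ℂ)
  have hcoe : ∀ f : PreLimit S, ψ' (f : Completion (PreLimit S)) = PreLimit.evLim ψ hinv f :=
    fun f => complExt_coe hL f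
  have hext : ∀ t b, ψ' (Limit.emb S t b) = ψ b := fun s b => by
    refine (hcoe (PreLimit.of S s b)).trans ?_
    obtain ⟨t, h1, h2⟩ := ((PreLimit.evLim_spec ψ hinv (PreLimit.of S s b)).and
      (eventually_le_atBot s)).exists
    rw [← h1, PreLimit.val_of, dif_pos (sub_nonneg.2 h2), hinv]
  have hdense : DenseRange fun p : T × B₀ => Limit.emb S p.1 p.2 := by
    rw [DenseRange, dense_iff_closure_eq, ← (Limit.isInductiveLimit S).dense]
    congr 1
    ext x
    simp
  refine ⟨ψ', ⟨fun x => ?_, le_antisymm ?_ ?_⟩, hext⟩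
  · refine hdense.induction (P := fun x => 0 ≤ ψ' (star x * x)) ?_
      (isClosed_le continuous_const (by fun_prop)) x
    rintro _ ⟨⟨s, b⟩, rfl⟩
    rw [← map_star, ← map_mul, hext]
    exact hψ.nonneg b
  · refine ContinuousLinearMap.opNorm_le_bound _ zero_le_one fun x => ?_
    refine hdense.induction (P := fun x => ‖ψ' x‖ ≤ 1 * ‖x‖) ?_
      (isClosed_le (by fun_prop) (by fun_prop)) x
    rintro _ ⟨⟨s, b⟩, rfl⟩
    rw [hext, Limit.norm_emb, ← hψ.norm_eq_one]
    exact ψ.le_opNorm b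
  · rw [← hψ.norm_eq_one]
    refine ContinuousLinearMap.opNorm_le_bound _ (norm_nonneg _) fun b => ?_
    rw [← hext 0 b, ← Limit.norm_emb S 0 b]
    exact ψ'.le_opNorm _

/-- Every state has a GNS triple. -/
theorem exists_isGNS.{u} {B : Type u} [NonUnitalCStarAlgebra B] {ψ : B →L[ℂ] ℂ} (hψ : IsState ψ) :
    ∃ (H : Type u) (_ : NormedAddCommGroup H) (_ : InnerProductSpace ℂ H) (_ : CompleteSpace H)
      (π : B →⋆ₙₐ[ℂ] (H →L[ℂ] H)) (Ω : H), IsGNS ψ π Ω := by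
  let _ := CStarAlgebra.spectralOrder B
  let _ := CStarAlgebra.spectralOrderedRing B
  let f : B →ₚ[ℂ] ℂ := PositiveLinearMap.mk₀ ψ.toLinearMap fun b hb => by
    obtain ⟨a, rfl⟩ := CStarAlgebra.nonneg_iff_eq_star_mul_self.1 hb
    exact hψ.nonneg a
  have hf : ∀ b, f b = ψ b := fun b => rfl
  have hnorm : ∀ a : f.PreGNS, ‖a‖ ^ 2 = ‖ψ (star (f.ofPreGNS a) * f.ofPreGNS a)‖ := fun a => by
    have := congrArg norm (f.preGNS_norm_sq a)
    simpa [hf] using this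
  have hle : ∀ a : f.PreGNS, ‖a‖ ≤ ‖f.ofPreGNS a‖ := fun a => by
    refine abs_le_of_sq_le_sq' ?_ (norm_nonneg _) |>.2
    rw [hnorm, sq, ← CStarRing.norm_star_mul_self]
    simpa [hψ.norm_eq_one] using ψ.le_opNorm (star (f.ofPreGNS a) * f.ofPreGNS a)
  have hbound : ∀ a : f.PreGNS, ‖ψ (f.ofPreGNS a)‖ ≤ 1 * ‖a‖ := fun a => by
    have hu := CStarAlgebra.increasingApproximateUnit B
    have ht : Tendsto (fun e => ‖ψ (e * f.ofPreGNS a)‖) (CStarAlgebra.approximateUnit B)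
        (𝓝 ‖ψ (f.ofPreGNS a)‖) :=
      ((ψ.continuous.tendsto _).comp (hu.tendsto_mul_right (f.ofPreGNS a))).norm
    refine le_of_tendsto ht ?_
    filter_upwards [hu.eventually_norm, hu.eventually_star_eq] with e he hes
    have h1 : ⟪f.toPreGNS e, a⟫_ℂ = ψ (e * f.ofPreGNS a) := by
      rw [f.preGNS_inner_def, f.ofPreGNS_toPreGNS, hes]
      rfl
    rw [← h1]
    refine (norm_inner_le_norm _ _).trans ?_
    gcongr
    exact (hle _).trans (by simpa using he)
  let ℓ : f.GNS →L[ℂ] ℂ := complExt (ψ.toLinearMap ∘ₗ f.ofPreGNS.toLinearMap)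
  have hℓ : ∀ a : f.PreGNS, ℓ (a : f.GNS) = ψ (f.ofPreGNS a) := fun a =>
    complExt_coe (f := ψ.toLinearMap ∘ₗ f.ofPreGNS.toLinearMap) (C := 1) hbound a
  let Ω : f.GNS := (InnerProductSpace.toDual ℂ f.GNS).symm ℓ
  have hΩ : ∀ ξ, ⟪Ω, ξ⟫_ℂ = ℓ ξ := fun ξ => InnerProductSpace.toDual_symm_apply
  have hπ : ∀ b, f.gnsNonUnitalStarAlgHom b Ω = (f.toPreGNS b : f.GNS) := fun b => by
    refine ext_inner_left ℂ fun ξ => ?_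
    induction ξ using Completion.induction_on with
    | hp => exact isClosed_eq (by fun_prop) (by fun_prop)
    | ih c =>
      rw [← ContinuousLinearMap.adjoint_inner_left, ← ContinuousLinearMap.star_eq_adjoint,
        ← map_star, PositiveLinearMap.gnsNonUnitalStarAlgHom_apply_coe, ← inner_conj_symm, hΩ, hℓ,
        ← inner_conj_symm (𝕜 := ℂ) (c : f.GNS), Completion.inner_coe, f.preGNS_inner_def]
      simp [PositiveLinearMap.leftMulMapPreGNS_apply, hf]
  refine ⟨f.GNS, inferInstance, inferInstance, inferInstance, f.gnsNonUnitalStarAlgHom, Ω,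
    le_antisymm ?_ ?_, fun b => ?_, ?_⟩
  · rw [LinearIsometryEquiv.norm_map]
    refine ContinuousLinearMap.opNorm_le_bound _ zero_le_one fun ξ => ?_
    induction ξ using Completion.induction_on with
    | hp => exact isClosed_le (by fun_prop) (by fun_prop)
    | ih a => simpa only [hℓ, Completion.norm_coe] using hbound a
  · rw [← hψ.norm_eq_one]
    refine ContinuousLinearMap.opNorm_le_bound _ (norm_nonneg _) fun b => ?_
    have h1 : ψ b = ⟪Ω, (f.toPreGNS b : f.GNS)⟫_ℂ := by rw [hΩ, hℓ, f.ofPreGNS_toPreGNS]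
    rw [h1]
    refine (norm_inner_le_norm _ _).trans ?_
    gcongr
    rw [Completion.norm_coe]
    exact hle _
  · rw [hπ, hΩ, hℓ, f.ofPreGNS_toPreGNS]
  · have : (fun b => f.gnsNonUnitalStarAlgHom b Ω) =
        ((↑) : f.PreGNS → f.GNS) ∘ f.toPreGNS := funext hπ
    rw [this]
    exact Completion.denseRange_coe.comp f.toPreGNS.surjective.denseRange
      (Completion.continuous_coe _)

end StateExtension

end InductiveLimitState

namespace InductiveLimitState

/-! ### The compressed dynamics in terms of the isometries `V_t`. -/

section CompressedDynamics

variable {T : Type*} [AddCommGroup T] [LinearOrder T] [IsOrderedAddMonoid T]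
variable {B₀ : Type*} [NonUnitalCStarAlgebra B₀]
variable {H : Type*} [NormedAddCommGroup H] [InnerProductSpace ℂ H] [CompleteSpace H]
variable {S : EndoSemigroup T B₀} {ψ : B₀ →L[ℂ] ℂ} {π : B₀ →⋆ₙₐ[ℂ] (H →L[ℂ] H)} {Ω : H}

/-! The correlation functions of `τ_t` always converge, and their limits are matrix elements of `Q`;
the mixing condition says that these are the matrix elements of the rank-one projection onto `Ω`.

On the side of `H₀`, `τ_t(x) Ω₀ = P V_t x Ω₀` and `τ_t(x)* = τ_t(x*)`, so `φ₀(τ_t(x) τ_t(y)) = ⟨V_t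
x* Ω₀, P V_t y Ω₀⟩` (`vectorState_markovMap_mul`). Both facts rest on `V_t* M' V_t ⊆ M'`, where `M =
π₀(B₀)''`; this replaces a normal extension of `λ_t`, which need not exist.

On the side of `H`, let `W_s : H₀ → H` be the isometry with `π₀(b) Ω₀ ↦ π(i_s(b)) Ω`. Conjugation by
`W_s` and by its adjoint exchanges elements of the commutants of `π₀(B₀)` and `π(B_[s)`, so `F_s]
W_s = W_s P` (`supportProj_gnsEmbedding`). From `i_s = i_{s-t} ∘ λ_t` follows `W_s = W_{s-t} V_t`,
hence `F_{s-t]} W_s = W_{s-t} P V_t` and `⟨W_s ξ, F_{s-t]} W_s η⟩ = ⟨V_t ξ, P V_t η⟩`. As `t → ∞`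
the left side tends to `⟨W_s ξ, Q W_s η⟩` (`tendsto_inner_implement`).

If `Q` has rank one, this limit, for one fixed `s`, is the product `φ₀(x) φ₀(y)`. Conversely, mixing
for `x = P π₀(b*) P` and `y = P π₀(b) P` gives the diagonal matrix elements of `Q` at the vectors
`π(i_s(b)) Ω` for all `s` and `b`. These vectors are dense, and a bounded operator on a complex
Hilbert space is determined by its quadratic form. -/

theorem supportProj_supportProj_apply (M : VonNeumannAlgebra H) (Ω ξ : H) :
    supportProj M Ω (supportProj M Ω ξ) = supportProj M Ω ξ :=
  DFunLike.congr_fun (isStarProjection_supportProj M Ω).isIdempotentElem ξ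

theorem inner_supportProj_left (M : VonNeumannAlgebra H) (Ω ξ η : H) :
    ⟪supportProj M Ω ξ, η⟫_ℂ = ⟪ξ, supportProj M Ω η⟫_ℂ :=
  Submodule.inner_starProjection_left_eq_right _ ξ η

theorem star_supportProj (M : VonNeumannAlgebra H) (Ω : H) :
    star (supportProj M Ω) = supportProj M Ω :=
  (isStarProjection_supportProj M Ω).isSelfAdjoint

/-- Two operators with the same matrix elements between vectors of the orbit `M'Ω` have the same
compression to `[M'Ω]`. -/
theorem supportProj_mul_mul_supportProj_eq {M : VonNeumannAlgebra H} {C D : H →L[ℂ] H}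
    (h : ∀ m ∈ M.commutant, ∀ n ∈ M.commutant, ⟪m Ω, C (n Ω)⟫_ℂ = ⟪m Ω, D (n Ω)⟫_ℂ) :
    supportProj M Ω * C * supportProj M Ω = supportProj M Ω * D * supportProj M Ω := by
  refine mul_supportProj_eq fun n hn => ?_
  -- Orthogonality to `M'Ω` passes to its closure, so the projection annihilates the difference.
  have hmem : C (n Ω) - D (n Ω) ∈ (supportSubspace M Ω)ᗮ := by
    rw [supportSubspace, Submodule.orthogonal_closure, Submodule.mem_orthogonal]
    rintro _ ⟨m, rfl⟩
    rw [inner_sub_right, sub_eq_zero]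
    exact h m m.2 n hn
  have h0 := (Submodule.starProjection_apply_eq_zero_iff (K := supportSubspace M Ω)).2 hmem
  rw [map_sub, sub_eq_zero] at h0
  exact h0

/-- The adjoint `V_t*` leaves `[M'Ω]` invariant: as `V_t Ω = Ω`, one has `V_t* m Ω = (V_t* m V_t)
Ω`, and `V_t* m V_t` lies in `M'`. Taking adjoints gives the claim. -/
theorem supportProj_implement_supportProj (h : IsGNS ψ π Ω) (hinv : ∀ t b, ψ (S.endo t b) = ψ b)
    (t : {t : T // 0 ≤ t}) :
    supportProj (vonNeumann π) Ω * implement S π Ω t * supportProj (vonNeumann π) Ω =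
      supportProj (vonNeumann π) Ω * implement S π Ω t := by
  have h1 : supportProj (vonNeumann π) Ω * star (implement S π Ω t) *
      supportProj (vonNeumann π) Ω =
      star (implement S π Ω t) * supportProj (vonNeumann π) Ω := by
    refine mul_supportProj_eq fun m hm => ?_
    have := supportProj_apply_orbit (Ω := Ω) (star_implement_mul_mul_mem h hinv t hm)
    simpa [implement_self h hinv] using this
  have h2 := congrArg star h1
  simpa [star_supportProj, mul_assoc] using h2

/-- A weak form of `λ_t(X)* = λ_t(X*)` that needs no extension of `λ_t`. The two sides are `⟨Ω, A X
Ω⟩` and `⟨Ω, X A Ω⟩` with `A = V_t* m* n V_t`, and `A` belongs to the commutant. -/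
theorem inner_inducedMul_star (h : IsGNS ψ π Ω) (hinv : ∀ t b, ψ (S.endo t b) = ψ b)
    (t : {t : T // 0 ≤ t}) {X m n : H →L[ℂ] H} (hX : X ∈ vonNeumann π)
    (hm : m ∈ (vonNeumann π).commutant) (hn : n ∈ (vonNeumann π).commutant) :
    ⟪m Ω, inducedMul S π Ω t X (n Ω)⟫_ℂ = ⟪inducedMul S π Ω t (star X) (m Ω), n Ω⟫_ℂ := by
  rw [inducedMul_apply_orbit h hinv t hX hn, inducedMul_apply_orbit h hinv t (star_mem hX) hm]
  set V := implement S π Ω t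
  have hV : V Ω = Ω := implement_self h hinv t
  have hA := star_implement_mul_mul_mem h hinv t (mul_mem (star_mem hm) hn)
  have hXA : X ((star V * (star m * n) * V) Ω) = (star V * (star m * n) * V) (X Ω) :=
    DFunLike.congr_fun (VonNeumannAlgebra.mem_commutant_iff.1 hA X hX) Ω
  have hXA' := congrArg (fun ξ => ⟪Ω, ξ⟫_ℂ) hXA
  simp only [← ContinuousLinearMap.adjoint_inner_left X, mul_apply_eq_comp,
    ContinuousLinearMap.star_eq_adjoint, ContinuousLinearMap.adjoint_inner_right, hV] at hXA'
  exact hXA'.symm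

theorem star_markovMap (h : IsGNS ψ π Ω) (hinv : ∀ t b, ψ (S.endo t b) = ψ b)
    (t : {t : T // 0 ≤ t}) {x : H →L[ℂ] H} (hx : x ∈ vonNeumann π) :
    star (markovMap S π Ω t x) = markovMap S π Ω t (star x) := by
  have hP := supportProj_mem (vonNeumann π) Ω
  have hX := mul_mem (mul_mem hP hx) hP
  simp only [markovMap, star_mul, star_supportProj, ← mul_assoc]
  -- Only compressions are compared, so matrix elements on the orbit `M'Ω`, where `inducedMul` is
  -- known explicitly, suffice.
  refine supportProj_mul_mul_supportProj_eq fun m hm n hn => ?_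
  rw [ContinuousLinearMap.star_eq_adjoint, ContinuousLinearMap.adjoint_inner_right]
  rw [← inner_conj_symm, inner_inducedMul_star h hinv t hX hn hm, inner_conj_symm]
  simp only [star_mul, star_supportProj, mul_assoc]

theorem markovMap_apply_self (h : IsGNS ψ π Ω) (hinv : ∀ t b, ψ (S.endo t b) = ψ b)
    (t : {t : T // 0 ≤ t}) {x : H →L[ℂ] H} (hx : x ∈ vonNeumann π) :
    markovMap S π Ω t x Ω = supportProj (vonNeumann π) Ω (implement S π Ω t (x Ω)) := by
  have hP := supportProj_mem (vonNeumann π) Ω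
  -- The vector `Ω` is the orbit point with `m = 1`. The factor `P` left between `V_t` and `x Ω` is
  -- removed at the end by `P V_t P = P V_t`.
  have key := inducedMul_apply_orbit h hinv t (mul_mem (mul_mem hP hx) hP)
    (one_mem (vonNeumann π).commutant)
  simp only [one_apply_eq_self, mul_apply_eq_comp, supportProj_apply_self] at key
  simp only [markovMap, mul_apply_eq_comp, supportProj_apply_self]
  rw [key]
  exact DFunLike.congr_fun (supportProj_implement_supportProj h hinv t) (x Ω)

/-- The correlation function of the compressed dynamics in terms of the isometries `V_t`. -/
theorem vectorState_markovMap_mul (h : IsGNS ψ π Ω) (hinv : ∀ t b, ψ (S.endo t b) = ψ b)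
    (t : {t : T // 0 ≤ t}) {x y : H →L[ℂ] H} (hx : x ∈ vonNeumann π) (hy : y ∈ vonNeumann π) :
    vectorState Ω (markovMap S π Ω t x * markovMap S π Ω t y) =
      ⟪implement S π Ω t (star x Ω),
        supportProj (vonNeumann π) Ω (implement S π Ω t (y Ω))⟫_ℂ := by
  rw [vectorState, mul_apply_eq_comp, ← ContinuousLinearMap.adjoint_inner_left,
    ← ContinuousLinearMap.star_eq_adjoint, star_markovMap h hinv t hx,
    markovMap_apply_self h hinv t (star_mem hx), markovMap_apply_self h hinv t hy,
    inner_supportProj_left, supportProj_supportProj_apply]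

theorem cornerAlgebra_subset : cornerAlgebra π Ω ⊆ vonNeumann π := by
  rintro _ ⟨X, hX, rfl⟩
  have hP := supportProj_mem (vonNeumann π) Ω
  exact mul_mem (mul_mem hP hX) hP

end CompressedDynamics

/-! ### The isometries `W` between the GNS spaces and the support projections. -/

section LocalEmbedding

variable {T : Type*} [AddCommGroup T] [LinearOrder T] [IsOrderedAddMonoid T]
variable {B₀ B : Type*} [NonUnitalCStarAlgebra B₀] [NonUnitalCStarAlgebra B]
variable {H H₀ : Type*} [NormedAddCommGroup H] [InnerProductSpace ℂ H] [CompleteSpace H]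
  [NormedAddCommGroup H₀] [InnerProductSpace ℂ H₀] [CompleteSpace H₀]

/-- The isometry of GNS spaces with `π₀(b) Ω₀ ↦ π(j(b)) Ω`, for a homomorphism `j` that preserves
the states. -/
noncomputable def gnsEmbedding (j : B₀ →⋆ₙₐ[ℂ] B) (π : B →⋆ₙₐ[ℂ] (H →L[ℂ] H)) (Ω : H)
    (π₀ : B₀ →⋆ₙₐ[ℂ] (H₀ →L[ℂ] H₀)) (Ω₀ : H₀) : H₀ →L[ℂ] H :=
  (orbit (π.comp j) Ω).extendOfNorm (orbit π₀ Ω₀)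

variable {S : EndoSemigroup T B₀} {ψ : B₀ →L[ℂ] ℂ} {ψ' : B →L[ℂ] ℂ} {j : B₀ →⋆ₙₐ[ℂ] B}
  {π : B →⋆ₙₐ[ℂ] (H →L[ℂ] H)} {Ω : H} {π₀ : B₀ →⋆ₙₐ[ℂ] (H₀ →L[ℂ] H₀)} {Ω₀ : H₀}

theorem norm_orbit_comp_eq (hπ : IsGNS ψ' π Ω) (hπ₀ : IsGNS ψ π₀ Ω₀)
    (hj : ∀ b, ψ' (j b) = ψ b) (b : B₀) : ‖orbit (π.comp j) Ω b‖ = ‖orbit π₀ Ω₀ b‖ := by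
  have : ⟪π (j b) Ω, π (j b) Ω⟫_ℂ = ⟪π₀ b Ω₀, π₀ b Ω₀⟫_ℂ := by
    rw [hπ.inner_apply_apply, hπ₀.inner_apply_apply, ← map_star, ← map_mul, hj]
  rw [inner_self_eq_norm_sq_to_K, inner_self_eq_norm_sq_to_K] at this
  have h2 : ‖π (j b) Ω‖ ^ 2 = ‖π₀ b Ω₀‖ ^ 2 := by exact_mod_cast this
  exact (sq_eq_sq₀ (norm_nonneg _) (norm_nonneg _)).1 h2

theorem gnsEmbedding_apply (hπ : IsGNS ψ' π Ω) (hπ₀ : IsGNS ψ π₀ Ω₀)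
    (hj : ∀ b, ψ' (j b) = ψ b) (b : B₀) :
    gnsEmbedding j π Ω π₀ Ω₀ (π₀ b Ω₀) = π (j b) Ω :=
  LinearMap.extendOfNorm_eq (f := orbit (π.comp j) Ω) (e := orbit π₀ Ω₀) hπ₀.cyclic
    ⟨1, fun b => by rw [norm_orbit_comp_eq hπ hπ₀ hj, one_mul]⟩ b

theorem norm_gnsEmbedding_apply (hπ : IsGNS ψ' π Ω) (hπ₀ : IsGNS ψ π₀ Ω₀)
    (hj : ∀ b, ψ' (j b) = ψ b) (ξ : H₀) : ‖gnsEmbedding j π Ω π₀ Ω₀ ξ‖ = ‖ξ‖ := by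
  refine hπ₀.cyclic.induction (P := fun ξ => ‖gnsEmbedding j π Ω π₀ Ω₀ ξ‖ = ‖ξ‖) ?_
    (isClosed_eq (by fun_prop) (by fun_prop)) ξ
  rintro _ ⟨b, rfl⟩
  rw [gnsEmbedding_apply hπ hπ₀ hj]
  exact norm_orbit_comp_eq hπ hπ₀ hj b

theorem inner_gnsEmbedding (hπ : IsGNS ψ' π Ω) (hπ₀ : IsGNS ψ π₀ Ω₀)
    (hj : ∀ b, ψ' (j b) = ψ b) (ξ η : H₀) :
    ⟪gnsEmbedding j π Ω π₀ Ω₀ ξ, gnsEmbedding j π Ω π₀ Ω₀ η⟫_ℂ = ⟪ξ, η⟫_ℂ :=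
  LinearIsometry.inner_map_map
    ⟨(gnsEmbedding j π Ω π₀ Ω₀).toLinearMap, norm_gnsEmbedding_apply hπ hπ₀ hj⟩ ξ η

theorem gnsEmbedding_intertwine (hπ : IsGNS ψ' π Ω) (hπ₀ : IsGNS ψ π₀ Ω₀)
    (hj : ∀ b, ψ' (j b) = ψ b) (b : B₀) :
    gnsEmbedding j π Ω π₀ Ω₀ ∘L π₀ b = π (j b) ∘L gnsEmbedding j π Ω π₀ Ω₀ := by
  ext ξ
  refine hπ₀.cyclic.induction
    (P := fun ξ => (gnsEmbedding j π Ω π₀ Ω₀ ∘L π₀ b) ξ =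
      (π (j b) ∘L gnsEmbedding j π Ω π₀ Ω₀) ξ) ?_
    (isClosed_eq (by fun_prop) (by fun_prop)) ξ
  rintro _ ⟨a, rfl⟩
  have : π₀ b (π₀ a Ω₀) = π₀ (b * a) Ω₀ := by simp
  simp only [ContinuousLinearMap.comp_apply]
  rw [this, gnsEmbedding_apply hπ hπ₀ hj, gnsEmbedding_apply hπ hπ₀ hj]
  simp

theorem adjoint_gnsEmbedding_intertwine (hπ : IsGNS ψ' π Ω) (hπ₀ : IsGNS ψ π₀ Ω₀)
    (hj : ∀ b, ψ' (j b) = ψ b) (b : B₀) :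
    (gnsEmbedding j π Ω π₀ Ω₀).adjoint ∘L π (j b) =
      π₀ b ∘L (gnsEmbedding j π Ω π₀ Ω₀).adjoint := by
  have h := congrArg ContinuousLinearMap.adjoint (gnsEmbedding_intertwine hπ hπ₀ hj (star b))
  simp only [ContinuousLinearMap.adjoint_comp, map_star, ContinuousLinearMap.star_eq_adjoint,
    ContinuousLinearMap.adjoint_adjoint] at h
  exact h.symm

/-- Without a unit this is not a case of the defining formula. By density `⟨Ω, W ξ⟩ = ⟨Ω₀, ξ⟩`, so
`Ω` and `W Ω₀` are unit vectors with inner product one, hence equal. -/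
theorem gnsEmbedding_self (hπ : IsGNS ψ' π Ω) (hπ₀ : IsGNS ψ π₀ Ω₀)
    (hj : ∀ b, ψ' (j b) = ψ b) : gnsEmbedding j π Ω π₀ Ω₀ Ω₀ = Ω := by
  have hcl : ∀ ξ, ⟪Ω, gnsEmbedding j π Ω π₀ Ω₀ ξ⟫_ℂ = ⟪Ω₀, ξ⟫_ℂ := by
    intro ξ
    refine hπ₀.cyclic.induction
      (P := fun ξ => ⟪Ω, gnsEmbedding j π Ω π₀ Ω₀ ξ⟫_ℂ = ⟪Ω₀, ξ⟫_ℂ) ?_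
      (isClosed_eq (by fun_prop) (by fun_prop)) ξ
    rintro _ ⟨b, rfl⟩
    rw [gnsEmbedding_apply hπ hπ₀ hj, hπ.inner_eq, hπ₀.inner_eq, hj]
  have key : ⟪Ω, gnsEmbedding j π Ω π₀ Ω₀ Ω₀⟫_ℂ = 1 := by
    rw [hcl, inner_self_eq_norm_sq_to_K, hπ₀.norm_eq_one]
    simp
  refine ((inner_eq_one_iff_of_norm_eq_one hπ.norm_eq_one ?_).1 key).symm
  rw [norm_gnsEmbedding_apply hπ hπ₀ hj, hπ₀.norm_eq_one]

/-- Both `W` and `W*` intertwine the two representations, so `π(j(b))` moves through `W n W*`,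
becoming `π₀(b)` in the middle. This and the companion result for `W* m W` relate the orbits of the
two commutants in both directions. -/
theorem gnsEmbedding_mem_commutant (hπ : IsGNS ψ' π Ω) (hπ₀ : IsGNS ψ π₀ Ω₀)
    (hj : ∀ b, ψ' (j b) = ψ b) {n : H₀ →L[ℂ] H₀} (hn : n ∈ (vonNeumann π₀).commutant) :
    gnsEmbedding j π Ω π₀ Ω₀ ∘L n ∘L (gnsEmbedding j π Ω π₀ Ω₀).adjoint ∈
      (vonNeumann (π.comp j)).commutant := by
  rw [mem_commutant_vonNeumann] at hn ⊢
  intro b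
  ext ξ
  have h1 := fun η => DFunLike.congr_fun (gnsEmbedding_intertwine hπ hπ₀ hj b) η
  have h2 := DFunLike.congr_fun (adjoint_gnsEmbedding_intertwine hπ hπ₀ hj b) ξ
  have h3 := fun η => DFunLike.congr_fun (hn b) η
  simp only [ContinuousLinearMap.comp_apply, mul_apply_eq_comp, NonUnitalStarAlgHom.comp_apply]
    at h1 h2 h3 ⊢
  rw [h2, ← h1, h3]

theorem adjoint_gnsEmbedding_mem_commutant (hπ : IsGNS ψ' π Ω) (hπ₀ : IsGNS ψ π₀ Ω₀)
    (hj : ∀ b, ψ' (j b) = ψ b) {m : H →L[ℂ] H} (hm : m ∈ (vonNeumann (π.comp j)).commutant) :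
    (gnsEmbedding j π Ω π₀ Ω₀).adjoint ∘L m ∘L gnsEmbedding j π Ω π₀ Ω₀ ∈
      (vonNeumann π₀).commutant := by
  rw [mem_commutant_vonNeumann] at hm ⊢
  intro b
  ext ξ
  have h1 := DFunLike.congr_fun (gnsEmbedding_intertwine hπ hπ₀ hj b) ξ
  have h2 := fun η => DFunLike.congr_fun (adjoint_gnsEmbedding_intertwine hπ hπ₀ hj b) η
  have h3 := fun η => DFunLike.congr_fun (hm b) η
  simp only [ContinuousLinearMap.comp_apply, mul_apply_eq_comp, NonUnitalStarAlgHom.comp_apply]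
    at h1 h2 h3 ⊢
  rw [h1, ← h2, h3]

/-- The isometry of GNS spaces intertwines the support projections. -/
theorem supportProj_gnsEmbedding (hπ : IsGNS ψ' π Ω) (hπ₀ : IsGNS ψ π₀ Ω₀)
    (hj : ∀ b, ψ' (j b) = ψ b) (ξ : H₀) :
    supportProj (vonNeumann (π.comp j)) Ω (gnsEmbedding j π Ω π₀ Ω₀ ξ) =
      gnsEmbedding j π Ω π₀ Ω₀ (supportProj (vonNeumann π₀) Ω₀ ξ) := by
  set W := gnsEmbedding j π Ω π₀ Ω₀ with hW
  have hWΩ : W Ω₀ = Ω := gnsEmbedding_self hπ hπ₀ hj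
  have hadjΩ : W.adjoint Ω = Ω₀ := by
    refine ext_inner_right ℂ fun η => ?_
    rw [ContinuousLinearMap.adjoint_inner_left, ← hWΩ, inner_gnsEmbedding hπ hπ₀ hj]
  -- The projection of `W ξ` is recognized by two properties of `W P ξ`: it lies in the support
  -- subspace, and `W ξ - W P ξ` is orthogonal to that subspace.
  refine Submodule.eq_starProjection_of_mem_of_inner_eq_zero ?_ ?_
  · have : supportSubspace (vonNeumann π₀) Ω₀ ≤
        (supportSubspace (vonNeumann (π.comp j)) Ω).comap W.toLinearMap := by
      refine Submodule.topologicalClosure_minimal _ ?_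
        ((Submodule.isClosed_topologicalClosure _).preimage W.continuous)
      rintro _ ⟨n, rfl⟩
      -- Since `W* Ω = Ω₀`, the vector `W n Ω₀` equals `(W n W*) Ω` and lies in the orbit of the
      -- commutant.
      have h1 := apply_mem_supportSubspace (Ω := Ω) (gnsEmbedding_mem_commutant hπ hπ₀ hj n.2)
      rw [← hW] at h1
      simp only [ContinuousLinearMap.comp_apply, hadjΩ] at h1
      exact h1
    exact this (Submodule.starProjection_apply_mem _ ξ)
  -- Orthogonality to a fixed vector is a closed linear condition, so it need only be checked on the
  -- orbit.
  · suffices h : supportSubspace (vonNeumann (π.comp j)) Ω ≤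
        (ℂ ∙ (W ξ - W (supportProj (vonNeumann π₀) Ω₀ ξ)))ᗮ by
      intro η hη
      exact Submodule.mem_orthogonal_singleton_iff_inner_right.1 (h hη)
    refine Submodule.topologicalClosure_minimal _ ?_ (Submodule.isClosed_orthogonal _)
    rintro _ ⟨m, rfl⟩
    rw [Submodule.mem_orthogonal_singleton_iff_inner_right, ← map_sub,
      ← ContinuousLinearMap.adjoint_inner_right]
    -- Since `W Ω₀ = Ω`, the vector `W* m Ω` equals `(W* m W) Ω₀`, which lies in the range of `P`
    -- and is thus orthogonal to `ξ - P ξ`.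
    have h1 := apply_mem_supportSubspace (Ω := Ω₀)
      (adjoint_gnsEmbedding_mem_commutant hπ hπ₀ hj m.2)
    rw [← hW] at h1
    simp only [ContinuousLinearMap.comp_apply, hWΩ] at h1
    exact Submodule.starProjection_inner_eq_zero _ _ h1

/-- The isometries of GNS spaces are compatible with the isometries `V_t`. -/
theorem gnsEmbedding_comp_implement (hπ : IsGNS ψ' π Ω) (hπ₀ : IsGNS ψ π₀ Ω₀)
    (hinv : ∀ t b, ψ (S.endo t b) = ψ b) (hj : ∀ b, ψ' (j b) = ψ b)
    (t : {t : T // 0 ≤ t}) (ξ : H₀) :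
    gnsEmbedding (j.comp (S.endo t)) π Ω π₀ Ω₀ ξ =
      gnsEmbedding j π Ω π₀ Ω₀ (implement S π₀ Ω₀ t ξ) := by
  refine hπ₀.cyclic.induction
    (P := fun ξ => gnsEmbedding (j.comp (S.endo t)) π Ω π₀ Ω₀ ξ =
      gnsEmbedding j π Ω π₀ Ω₀ (implement S π₀ Ω₀ t ξ)) ?_
    (isClosed_eq (by fun_prop) (by fun_prop)) ξ
  rintro _ ⟨b, rfl⟩
  rw [implement_apply hπ₀ hinv, gnsEmbedding_apply hπ hπ₀ hj,
    gnsEmbedding_apply hπ hπ₀ fun b => by simp [hj, hinv]]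
  rfl

/-! ### The filtration seen from `H₀`, and the limit `Q`. -/

variable {i : T → (B₀ →⋆ₙₐ[ℂ] B)}

/-- Here `W_s = W_{s-t} V_t`, because `i_s = i_{s-t} ∘ λ_t`, and `F_{s-t]}` passes through `W_{s-t}`
as `P`. -/
theorem filtration_gnsEmbedding (hi : IsInductiveLimit S i) (hπ : IsGNS ψ' π Ω)
    (hπ₀ : IsGNS ψ π₀ Ω₀) (hinv : ∀ t b, ψ (S.endo t b) = ψ b) (hext : ∀ t b, ψ' (i t b) = ψ b)
    (s : T) (t : {t : T // 0 ≤ t}) (ξ : H₀) :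
    filtration i π Ω (s - t) (gnsEmbedding (i s) π Ω π₀ Ω₀ ξ) =
      gnsEmbedding (i (s - t)) π Ω π₀ Ω₀
        (supportProj (vonNeumann π₀) Ω₀ (implement S π₀ Ω₀ t ξ)) := by
  have hs : i s = (i (s - t)).comp (S.endo t) := by
    ext b
    simpa using hi.compat (s - t) t b
  rw [hs, gnsEmbedding_comp_implement hπ hπ₀ hinv (hext _)]
  exact supportProj_gnsEmbedding hπ hπ₀ (hext _) _

/-- This turns the varying projections on `H` into one fixed projection `P` on `H₀`, with the time
dependence carried by `V_t`. The right side no longer contains `s`. -/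
theorem inner_filtration_gnsEmbedding (hi : IsInductiveLimit S i) (hπ : IsGNS ψ' π Ω)
    (hπ₀ : IsGNS ψ π₀ Ω₀) (hinv : ∀ t b, ψ (S.endo t b) = ψ b) (hext : ∀ t b, ψ' (i t b) = ψ b)
    (s : T) (t : {t : T // 0 ≤ t}) (ξ η : H₀) :
    ⟪gnsEmbedding (i s) π Ω π₀ Ω₀ ξ,
      filtration i π Ω (s - t) (gnsEmbedding (i s) π Ω π₀ Ω₀ η)⟫_ℂ =
      ⟪implement S π₀ Ω₀ t ξ,
        supportProj (vonNeumann π₀) Ω₀ (implement S π₀ Ω₀ t η)⟫_ℂ := by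
  -- The projection is doubled so that each argument of the inner product gets one copy; both then
  -- lie in the range of the isometry `W_{s-t}`, which can be cancelled.
  have hF : filtration i π Ω (s - t) (gnsEmbedding (i s) π Ω π₀ Ω₀ η) =
      filtration i π Ω (s - t) (filtration i π Ω (s - t) (gnsEmbedding (i s) π Ω π₀ Ω₀ η)) :=
    (supportProj_supportProj_apply _ _ _).symm
  have hF' : ∀ ζ χ : H, ⟪ζ, filtration i π Ω (s - t) χ⟫_ℂ = ⟪filtration i π Ω (s - t) ζ, χ⟫_ℂ :=
    fun ζ χ => (inner_supportProj_left _ _ _ _).symm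
  rw [hF, hF', filtration_gnsEmbedding hi hπ hπ₀ hinv hext,
    filtration_gnsEmbedding hi hπ hπ₀ hinv hext, inner_gnsEmbedding hπ hπ₀ (hext _),
    inner_supportProj_left, supportProj_supportProj_apply]

theorem tendsto_sub_coe_atBot (s : T) :
    Tendsto (fun t : {t : T // 0 ≤ t} => s - (t : T)) atTop atBot := by
  refine tendsto_atBot.2 fun r => ?_
  -- The bound `s - r` is what forces `s - t ≤ r`; the maximum with `0` places it in the positive
  -- cone.
  filter_upwards [eventually_ge_atTop (⟨max (s - r) 0, le_max_right _ _⟩ : {t : T // 0 ≤ t})]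
    with t ht
  exact sub_le_comm.1 ((le_max_left _ _).trans (Subtype.coe_le_coe.2 ht))

/-- The matrix elements of `P` between the vectors `V_t ξ` and `V_t η` converge to those of `Q`. -/
theorem tendsto_inner_implement (hi : IsInductiveLimit S i) (hπ : IsGNS ψ' π Ω)
    (hπ₀ : IsGNS ψ π₀ Ω₀) (hinv : ∀ t b, ψ (S.endo t b) = ψ b) (hext : ∀ t b, ψ' (i t b) = ψ b)
    (s : T) (ξ η : H₀) :
    Tendsto (fun t => ⟪implement S π₀ Ω₀ t ξ,
        supportProj (vonNeumann π₀) Ω₀ (implement S π₀ Ω₀ t η)⟫_ℂ) atTop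
      (𝓝 ⟪gnsEmbedding (i s) π Ω π₀ Ω₀ ξ,
        limitProj i π Ω (gnsEmbedding (i s) π Ω π₀ Ω₀ η)⟫_ℂ) := by
  simp only [← inner_filtration_gnsEmbedding hi hπ hπ₀ hinv hext s]
  exact tendsto_const_nhds.inner ((tendsto_filtration hi π Ω _).comp (tendsto_sub_coe_atBot s))

/-- The map `b ↦ π(b) Ω` is a contraction with dense range, so it carries the dense union of the
subalgebras `B_[t` to a dense set. -/
theorem denseRange_apply_apply (hi : IsInductiveLimit S i) (hπ : IsGNS ψ' π Ω) :
    DenseRange fun p : T × B₀ => π (i p.1 p.2) Ω := by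
  have hd : DenseRange fun p : T × B₀ => i p.1 p.2 := by
    rw [DenseRange, dense_iff_closure_eq, ← hi.dense]
    congr 1
    ext x
    simp
  have hbound : ∀ b, ‖orbit π Ω b‖ ≤ 1 * ‖b‖ := fun b => by
    refine ((π b).le_opNorm Ω).trans ?_
    rw [hπ.norm_eq_one, mul_one, one_mul]
    exact NonUnitalStarAlgHom.norm_apply_le π b
  have hc : Continuous fun b => π b Ω :=
    ((orbit π Ω).mkContinuous 1 hbound).continuous
  exact hπ.cyclic.comp hd hc

/-- Diagonal matrix elements suffice: by continuity the two quadratic forms agree on all of `H`, and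
polarization over `ℂ` then identifies the operators. -/
theorem limitProj_eq_rankOne (hi : IsInductiveLimit S i) (hπ : IsGNS ψ' π Ω)
    (h : ∀ t b, ⟪π (i t b) Ω, limitProj i π Ω (π (i t b) Ω)⟫_ℂ =
      ⟪π (i t b) Ω, Ω⟫_ℂ * ⟪Ω, π (i t b) Ω⟫_ℂ) :
    limitProj i π Ω = InnerProductSpace.rankOne ℂ Ω Ω := by
  have hall : ∀ ξ, ⟪ξ, limitProj i π Ω ξ⟫_ℂ = ⟪ξ, InnerProductSpace.rankOne ℂ Ω Ω ξ⟫_ℂ := by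
    intro ξ
    refine (denseRange_apply_apply hi hπ).induction
      (P := fun ξ => ⟪ξ, limitProj i π Ω ξ⟫_ℂ = ⟪ξ, InnerProductSpace.rankOne ℂ Ω Ω ξ⟫_ℂ) ?_
      (isClosed_eq (by fun_prop) (by fun_prop)) ξ
    rintro _ ⟨p, rfl⟩
    rw [h, InnerProductSpace.rankOne_apply, inner_smul_right, mul_comm]
  have := (ext_inner_map (limitProj i π Ω).toLinearMap
    (InnerProductSpace.rankOne ℂ Ω Ω).toLinearMap).1 fun ξ => by
      -- Polarization is stated with the operator in the first argument of the inner product, hence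
      -- the conjugation.
      have := congrArg (starRingEnd ℂ) (hall ξ)
      rwa [inner_conj_symm, inner_conj_symm] at this
  exact ContinuousLinearMap.coe_injective this

end LocalEmbedding

end InductiveLimitState

/-! ### The equivalence. -/

theorem theorem3p3 {T : Type*} [AddCommGroup T] [LinearOrder T] [IsOrderedAddMonoid T]
    {B₀ B H H₀ : Type*} [NonUnitalCStarAlgebra B₀] [NonUnitalCStarAlgebra B]
    [NormedAddCommGroup H] [InnerProductSpace ℂ H] [CompleteSpace H]
    [NormedAddCommGroup H₀] [InnerProductSpace ℂ H₀] [CompleteSpace H₀]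
    -- the semigroup of injective endomorphisms of `B₀` and the invariant state
    (S : InductiveLimitState.EndoSemigroup T B₀)
    (ψ : B₀ →L[ℂ] ℂ) (hψ : InductiveLimitState.IsState ψ) (hinv : ∀ t b, ψ (S.endo t b) = ψ b)
    -- the inductive limit and the extended state
    (i : T → (B₀ →⋆ₙₐ[ℂ] B)) (hi : InductiveLimitState.IsInductiveLimit S i)
    (ψ' : B →L[ℂ] ℂ) (hψ' : InductiveLimitState.IsState ψ') (hext : ∀ t b, ψ' (i t b) = ψ b)
    -- the GNS triples of the extended state and of the given state
    (π : B →⋆ₙₐ[ℂ] (H →L[ℂ] H)) (Ω : H) (hπ : InductiveLimitState.IsGNS ψ' π Ω)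
    (π₀ : B₀ →⋆ₙₐ[ℂ] (H₀ →L[ℂ] H₀)) (Ω₀ : H₀) (hπ₀ : InductiveLimitState.IsGNS ψ π₀ Ω₀) :
    InductiveLimitState.limitProj i π Ω = InnerProductSpace.rankOne ℂ Ω Ω ↔
      ∀ x ∈ InductiveLimitState.cornerAlgebra π₀ Ω₀, ∀ y ∈ InductiveLimitState.cornerAlgebra π₀ Ω₀,
        Tendsto
          (fun t => InductiveLimitState.vectorState Ω₀
            (InductiveLimitState.markovMap S π₀ Ω₀ t x * InductiveLimitState.markovMap S π₀ Ω₀ t y))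
          atTop
          (𝓝 (InductiveLimitState.vectorState Ω₀ x * InductiveLimitState.vectorState Ω₀ y)) := by
  constructor
  · intro hQ x hx y hy
    have hx' := InductiveLimitState.cornerAlgebra_subset hx
    have hy' := InductiveLimitState.cornerAlgebra_subset hy
    have hW := InductiveLimitState.gnsEmbedding_self hπ hπ₀ (hext 0)
    simp only [InductiveLimitState.vectorState_markovMap_mul hπ₀ hinv _ hx' hy']
    -- The correlation function does not depend on `s`, so any base point would serve. It remains to
    -- evaluate the limit `⟨W x* Ω₀, Q W y Ω₀⟩` for `Q = |Ω⟩⟨Ω|`.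
    convert InductiveLimitState.tendsto_inner_implement hi hπ hπ₀ hinv hext 0
      (star x Ω₀) (y Ω₀) using 2
    have h1 : ∀ ξ, ⟪InductiveLimitState.gnsEmbedding (i 0) π Ω π₀ Ω₀ ξ, Ω⟫_ℂ = ⟪ξ, Ω₀⟫_ℂ := by
      intro ξ
      have := InductiveLimitState.inner_gnsEmbedding hπ hπ₀ (hext 0) ξ Ω₀
      rwa [hW] at this
    have h2 : ∀ ξ, ⟪Ω, InductiveLimitState.gnsEmbedding (i 0) π Ω π₀ Ω₀ ξ⟫_ℂ = ⟪Ω₀, ξ⟫_ℂ :=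
      fun ξ => by rw [← inner_conj_symm, h1, inner_conj_symm]
    rw [hQ, InnerProductSpace.rankOne_apply, inner_smul_right, h1, h2,
      ContinuousLinearMap.star_eq_adjoint, ContinuousLinearMap.adjoint_inner_left, mul_comm]
    rfl
  · intro hmix
    refine InductiveLimitState.limitProj_eq_rankOne hi hπ fun s b => ?_
    set P := InductiveLimitState.supportProj (InductiveLimitState.vonNeumann π₀) Ω₀ with hPdef
    have hmem : ∀ b, P * π₀ b * P ∈ InductiveLimitState.cornerAlgebra π₀ Ω₀ :=
      fun b => ⟨π₀ b, InductiveLimitState.map_mem_vonNeumann _ _, rfl⟩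
    have hPΩ : P Ω₀ = Ω₀ := InductiveLimitState.supportProj_apply_self _ _
    have hφ : ∀ b, InductiveLimitState.vectorState Ω₀ (P * π₀ b * P) = ψ b := fun b => by
      simp only [InductiveLimitState.vectorState, mul_apply_eq_comp, hPΩ]
      rw [hPdef, ← InductiveLimitState.inner_supportProj_left,
        InductiveLimitState.supportProj_apply_self, hπ₀.inner_eq]
    -- With `y = P π₀(b) P` this choice makes `x* = y`, so the correlation function is a diagonal
    -- matrix element.
    have hlim := hmix _ (hmem (star b)) _ (hmem b)
    have hval : ∀ b, (P * π₀ b * P) Ω₀ = P (π₀ b Ω₀) := fun b => by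
      simp only [mul_apply_eq_comp, hPΩ]
    -- The corner element gives only `y Ω₀ = P π₀(b) Ω₀`. The relation `P V_t P = P V_t` removes
    -- this `P`, leaving `π₀(b) Ω₀`, which `W_s` maps to `π(i_s(b)) Ω`.
    have hPV : ∀ t ξ, P (InductiveLimitState.implement S π₀ Ω₀ t (P ξ)) =
        P (InductiveLimitState.implement S π₀ Ω₀ t ξ) := fun t ξ =>
      DFunLike.congr_fun (InductiveLimitState.supportProj_implement_supportProj hπ₀ hinv t) ξ
    have hstar : star (P * π₀ (star b) * P) = P * π₀ b * P := by
      simp only [star_mul, map_star, star_star, hPdef, InductiveLimitState.star_supportProj,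
        mul_assoc]
    have hcorr : ∀ t, InductiveLimitState.vectorState Ω₀
        (InductiveLimitState.markovMap S π₀ Ω₀ t (P * π₀ (star b) * P) *
          InductiveLimitState.markovMap S π₀ Ω₀ t (P * π₀ b * P)) =
        ⟪InductiveLimitState.implement S π₀ Ω₀ t (π₀ b Ω₀),
          P (InductiveLimitState.implement S π₀ Ω₀ t (π₀ b Ω₀))⟫_ℂ := fun t => by
      rw [InductiveLimitState.vectorState_markovMap_mul hπ₀ hinv t
        (InductiveLimitState.cornerAlgebra_subset (hmem _))
        (InductiveLimitState.cornerAlgebra_subset (hmem _)), hstar, hval, ← hPdef, hPV,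
        -- The outer `P` is moved to the first argument so that the inner `P` there can be removed
        -- as well, and is then moved back.
        hPdef, ← InductiveLimitState.inner_supportProj_left, ← hPdef, hPV, hPdef,
        InductiveLimitState.inner_supportProj_left]
    simp only [hcorr, hφ] at hlim
    -- For every `s` the same function of `t` also tends to the diagonal matrix element of `Q` at
    -- `W_s π₀(b) Ω₀`, so the two limits coincide.
    have huniq := tendsto_nhds_unique
      (InductiveLimitState.tendsto_inner_implement hi hπ hπ₀ hinv hext s (π₀ b Ω₀) (π₀ b Ω₀)) hlim
    rw [InductiveLimitState.gnsEmbedding_apply hπ hπ₀ (hext s)] at huniq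
    have h1 : ⟪π (i s b) Ω, Ω⟫_ℂ = ψ (star b) := by
      rw [← ContinuousLinearMap.adjoint_inner_right, ← ContinuousLinearMap.star_eq_adjoint,
        ← map_star, ← map_star, hπ.inner_eq, hext]
    rw [huniq, h1, hπ.inner_eq, hext]
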